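/- Let $\Theta\subset\mathbb R^{d}$ be compact, let $P_Z$ be a probability measure on a measurable space $\mathcal Z$, and let $\tau(\theta,\cdot):\mathcal Z\to\mathbb R^p$ be measurable for every $\theta\in\Theta$. Suppose there is an integrable $L:\mathcal Z\to\mathbb R$ such that, for $P_Z$-almost every $z$, \[\|\tau(\theta_1,z)-\tau(\theta_2,z)\|\le L(z)\,\|\theta_1-\theta_2\|\qquad\text{for all }\theta_1,\theta_2\in\Theta,\] and that, for $Z\sim P_Z$, the vectors $\tau(\theta,Z)$ are sub-Gaussian uniformly over $\Theta$: \[\sup_{\theta\in\Theta}\ \sup_{\|\omega\|=1}\big\|\omega^{T}\tau(\theta,Z)\big\|_{\psi_2}<\infty,\qquad \|Y\|_{\psi_2}:=\inf\{K>0:\ \mathbb E\exp(Y^2/K^2)\le 2\}.\] Let $P_\theta$ be the law of $\tau(\theta,Z)$ and, for $Z_1,\dots,Z_m$ i.i.d. from $P_Z$, let $Q_m^\theta=\frac1m\sum_{j=1}^m\delta_{\tau(\theta,Z_j)}$. Let \[d_{\mathrm{SW}}(\mu,\nu)=\int_{\mathbb S^{p-1}}W_1(\mu_\omega,\nu_\omega)\,d\sigma(\omega),\]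 where $\sigma$ is the uniform probability measure on the unit sphere, $\mu_\omega,\nu_\omega$ are the images of $\mu,\nu$ under $x\mapsto\omega^{T}x$, and $W_1$ is the 1-Wasserstein distance on $\mathbb R$. Then \[\sup_{\theta\in\Theta}d_{\mathrm{SW}}(Q_m^\theta,P_\theta)=O_p(m^{-1/2}),\] that is, for every $\varepsilon>0$ there is $C<\infty$ such that for all $m\ge1$ the (outer) probability that $\sup_{\theta\in\Theta}d_{\mathrm{SW}}(Q_m^\theta,P_\theta)>C\,m^{-1/2}$ is at most $\varepsilon$. -/

import Mathlib

open MeasureTheory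
open scoped ENNReal NNReal

noncomputable section

namespace SlicedW

/-- The 1-Wasserstein distance of two measures on the line: the infimum of the transport cost
`∫ |x - y| dπ` over all couplings `π`. -/
def wasserstein1 (μ ν : Measure ℝ) : ℝ≥0∞ :=
  ⨅ (π : Measure (ℝ × ℝ)) (_ : π.fst = μ ∧ π.snd = ν), ∫⁻ q, ENNReal.ofReal |q.1 - q.2| ∂π

/-- The uniform probability measure on the unit sphere of `ℝ^p`
(normalized surface measure). -/
def sphereUniform (p : ℕ) : Measure (Metric.sphere (0 : EuclideanSpace ℝ (Fin p)) 1) :=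
  ((volume : Measure (EuclideanSpace ℝ (Fin p))).toSphere Set.univ)⁻¹ •
    (volume : Measure (EuclideanSpace ℝ (Fin p))).toSphere

/-- The law of `⟨ω, X⟩` for `X` of law `μ`. -/
def proj {p : ℕ} (μ : Measure (EuclideanSpace ℝ (Fin p))) (ω : EuclideanSpace ℝ (Fin p)) :
    Measure ℝ :=
  μ.map (fun x => inner ℝ ω x)

/-- The sliced 1-Wasserstein distance. -/
def slicedW {p : ℕ} (μ ν : Measure (EuclideanSpace ℝ (Fin p))) : ℝ≥0∞ :=
  ∫⁻ ω, wasserstein1 (proj μ ω) (proj ν ω) ∂(sphereUniform p)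

/-- The sub-Gaussian norm `inf {K > 0 : E exp (Y² / K²) ≤ 2}` of a real random variable `Y` of
law `ν`; it is `∞` if `Y` is not sub-Gaussian. -/
def psi2Norm (ν : Measure ℝ) : ℝ≥0∞ :=
  ⨅ (K : ℝ≥0) (_ : 0 < K ∧ ∫⁻ y, ENNReal.ofReal (Real.exp (y ^ 2 / (K : ℝ) ^ 2)) ∂ν ≤ 2),
    (K : ℝ≥0∞)

/-- The sub-Gaussian norm of a random vector of law `μ`: the supremum of the sub-Gaussian norms
of its projections on unit directions. -/
def psi2NormVec {p : ℕ} (μ : Measure (EuclideanSpace ℝ (Fin p))) : ℝ≥0∞ :=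
  ⨆ ω : Metric.sphere (0 : EuclideanSpace ℝ (Fin p)) 1, psi2Norm (proj μ ω)

/-- The empirical measure `m⁻¹ ∑ⱼ δ_{x j}`. -/
def empirical {p m : ℕ} (x : Fin m → EuclideanSpace ℝ (Fin p)) :
    Measure (EuclideanSpace ℝ (Fin p)) :=
  (m : ℝ≥0∞)⁻¹ • ∑ j, Measure.dirac (x j)

/-- `X m = O_p(a m)`: for every `ε > 0` there is a finite `C` such that
`P(X m > C * a m) ≤ ε` for all `m ≥ 1`. The variable `X m` may live on its own probability
space; on a set that is not measurable, `μ m` is the outer probability. -/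
def IsBigOp {Ω : ℕ → Type*} [∀ m, MeasurableSpace (Ω m)] (μ : ∀ m, Measure (Ω m))
    (X : ∀ m, Ω m → ℝ≥0∞) (a : ℕ → ℝ) : Prop :=
  ∀ ε : ℝ, 0 < ε → ∃ C : ℝ, 0 < C ∧ ∀ m : ℕ, 1 ≤ m →
    μ m {z | ENNReal.ofReal (C * a m) < X m z} ≤ ENNReal.ofReal ε

end SlicedW

end

/-! On the line, W₁ is at most the L¹ distance of distribution functions. Hence the sliced distance
between the empirical law and the law of τ(θ,Z) is at most the L¹ norm, over directions and
thresholds (ω,t), of the centred empirical mean of the indicators 1{⟨ω,τ(θ,z)⟩ ≤ t}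
(`slicedW_le_devNorm`). It remains to chain this norm over Θ.

The indicators are discontinuous in θ, but the t-integral of the difference of two of them is at
most ‖τ(θ,z) − τ(θ',z)‖. For a pair of maps T, T' put D = ‖T − T'‖ and suppose E D ≤ β⁴ and
exp(6‖T‖), exp(6‖T'‖) have bounded means. The L¹ norm of the increment then has mean O(β m^{-1/2}),
by a variance bound with weight 1 + t². Replacing one sample point moves it by at most (D(z_j) +
D(z_j'))/m, so integrating out one coordinate at a time controls its exponential moment
(`lintegral_exp_le_of_bounded_differences`). Consequently √m times the increment has a bounded
exponential moment at scale β, provided β⁻¹ ≤ √m (`lintegral_exp_devNorm_sliceDiff_le`).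

Losing a fourth root is harmless in finite dimension: nets of mesh 16⁻ᵏ have log-cardinality O(k)
and correspond to β = b 2⁻ᵏ, so the maximal inequality `exists_majorant` costs O((k+1) 2⁻ᵏ) at level
k, which is summable. The chain stops once 16ᵏ ≥ √m; below that mesh the Lipschitz bound suffices
without any cancellation. Markov's inequality for the resulting majorant concludes. -/

noncomputable section

namespace SlicedW

/-! ### Exponential moments from controlled differences. -/

section Exponential

/-- Second-order Taylor remainder of the exponential. The linear term is kept exact because it
vanishes in the mean for a centred variable. -/
lemma exp_le_one_add_sq_mul_exp (y : ℝ) :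
    Real.exp y ≤ 1 + y + y ^ 2 * Real.exp |y| := by
  have h := Complex.norm_exp_sub_sum_le_norm_mul_exp (y : ℂ) 2
  have h' : (Complex.exp (y : ℂ) - ∑ m ∈ Finset.range 2, (y : ℂ) ^ m / (m.factorial : ℂ))
      = ((Real.exp y - (1 + y) : ℝ) : ℂ) := by
    simp [Finset.sum_range_succ]
  rw [h', Complex.norm_real, Complex.norm_real, Real.norm_eq_abs, Real.norm_eq_abs, sq_abs] at h
  linarith [le_abs_self (Real.exp y - (1 + y))]

variable {𝒵 : Type*} [MeasurableSpace 𝒵] {P : Measure 𝒵} [IsProbabilityMeasure P]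

/-- Exponential moment of a variable whose oscillation is controlled by `g`. -/
lemma lintegral_exp_le_of_osc_le {g Y : 𝒵 → ℝ} {lam r : ℝ}
    (hgm : Measurable g) (hgi : Integrable g P) (hlam : 0 ≤ lam)
    (hr : ∫⁻ x, ENNReal.ofReal ((lam * (g x + ∫ y, g y ∂P)) ^ 2
      * Real.exp (lam * (g x + ∫ y, g y ∂P))) ∂P ≤ ENNReal.ofReal r) (hr0 : 0 ≤ r)
    (hY : Integrable Y P) (hosc : ∀ x y, |Y x - Y y| ≤ g x + g y) :
    ∫⁻ x, ENNReal.ofReal (Real.exp (lam * Y x)) ∂P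
      ≤ ENNReal.ofReal (Real.exp (lam * ∫ x, Y x ∂P + r)) := by
  set c := ∫ y, g y ∂P with hc
  set a := ∫ y, Y y ∂P with ha
  -- Averaging the oscillation bound over the second point turns `Y y` into the mean and `g y` into
  -- `c`.
  have hdev : ∀ x, |Y x - a| ≤ g x + c := by
    intro x
    have h1 : Y x - a = ∫ y, (Y x - Y y) ∂P := by
      rw [integral_sub (integrable_const _) hY]; simp [ha]
    have h2 : g x + c = ∫ y, (g x + g y) ∂P := by
      rw [integral_add (integrable_const _) hgi]; simp [hc]
    rw [h1, h2]
    exact (abs_integral_le_integral_abs).trans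
      (integral_mono ((integrable_const _).sub hY).abs ((integrable_const _).add hgi)
        (fun y => hosc x y))
  set W : 𝒵 → ℝ := fun x => (lam * (g x + c)) ^ 2 * Real.exp (lam * (g x + c)) with hW
  have hWm : Measurable W := by fun_prop
  have hW0 : ∀ x, 0 ≤ W x := fun x => by positivity
  have hWi : Integrable W P := by
    refine ⟨hWm.aestronglyMeasurable, ?_⟩
    rw [hasFiniteIntegral_iff_ofReal (Filter.Eventually.of_forall hW0)]
    exact hr.trans_lt ENNReal.ofReal_lt_top
  have hWr : ∫ x, W x ∂P ≤ r := by
    rw [integral_eq_lintegral_of_nonneg_ae (Filter.Eventually.of_forall hW0)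
      hWm.aestronglyMeasurable]
    exact ENNReal.toReal_le_of_le_ofReal hr0 hr
  have hpt : ∀ x, Real.exp (lam * (Y x - a)) ≤ 1 + lam * (Y x - a) + W x := by
    intro x
    refine (exp_le_one_add_sq_mul_exp _).trans ?_
    have h1 : |lam * (Y x - a)| ≤ lam * (g x + c) := by
      rw [abs_mul, abs_of_nonneg hlam]
      exact mul_le_mul_of_nonneg_left (hdev x) hlam
    have h2 : (lam * (Y x - a)) ^ 2 ≤ (lam * (g x + c)) ^ 2 := by
      rw [← sq_abs]; gcongr
    have h3 := mul_le_mul h2 (Real.exp_le_exp.2 h1) (Real.exp_pos _).le (sq_nonneg _)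
    simp only [hW]
    linarith
  have hi₁ : Integrable (fun x => lam * (Y x - a)) P :=
    (hY.sub (integrable_const _)).const_mul _
  have hi₂ : Integrable (fun x => 1 + lam * (Y x - a)) P := (integrable_const _).add hi₁
  have hRi : Integrable (fun x => 1 + lam * (Y x - a) + W x) P := hi₂.add hWi
  -- The linear term integrates to zero; only the quadratic remainder `W` contributes.
  have hR : ∫ x, (1 + lam * (Y x - a) + W x) ∂P ≤ 1 + r := by
    rw [integral_add hi₂ hWi, integral_add (integrable_const _) hi₁,
      integral_const_mul, integral_sub hY (integrable_const _)]
    simp [← ha]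
    exact hWr
  have hfac : ∀ x, ENNReal.ofReal (Real.exp (lam * Y x))
      = ENNReal.ofReal (Real.exp (lam * a)) * ENNReal.ofReal (Real.exp (lam * (Y x - a))) := by
    intro x
    rw [← ENNReal.ofReal_mul (Real.exp_pos _).le, ← Real.exp_add]
    ring_nf
  simp_rw [hfac]
  rw [lintegral_const_mul' _ _ ENNReal.ofReal_ne_top, Real.exp_add,
    ENNReal.ofReal_mul (Real.exp_pos _).le]
  gcongr
  calc ∫⁻ x, ENNReal.ofReal (Real.exp (lam * (Y x - a))) ∂P
      ≤ ∫⁻ x, ENNReal.ofReal (1 + lam * (Y x - a) + W x) ∂P :=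
        lintegral_mono fun x => ENNReal.ofReal_le_ofReal (hpt x)
    _ = ENNReal.ofReal (∫ x, (1 + lam * (Y x - a) + W x) ∂P) := by
        rw [ofReal_integral_eq_lintegral_ofReal hRi]
        exact Filter.Eventually.of_forall fun x => (Real.exp_pos _).le.trans (hpt x)
    _ ≤ ENNReal.ofReal (Real.exp r) := by
        refine ENNReal.ofReal_le_ofReal (hR.trans ?_)
        linarith [Real.add_one_le_exp r]

/-- Exponential moment of a function of independent variables with controlled differences. -/
theorem lintegral_exp_le_of_bounded_differences {g : 𝒵 → ℝ} {lam r : ℝ}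
    (hgm : Measurable g) (hgi : Integrable g P) (hlam : 0 ≤ lam)
    (hr : ∫⁻ x, ENNReal.ofReal ((lam * (g x + ∫ y, g y ∂P)) ^ 2
      * Real.exp (lam * (g x + ∫ y, g y ∂P))) ∂P ≤ ENNReal.ofReal r) (hr0 : 0 ≤ r)
    (m : ℕ) (f : (Fin m → 𝒵) → ℝ) (hfm : Measurable f)
    (hf : Integrable f (Measure.pi fun _ => P))
    (hbd : ∀ z z' j, (∀ i, i ≠ j → z i = z' i) → |f z - f z'| ≤ g (z j) + g (z' j)) :
    ∫⁻ z, ENNReal.ofReal (Real.exp (lam * f z)) ∂(Measure.pi fun _ => P)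
      ≤ ENNReal.ofReal (Real.exp (lam * ∫ z, f z ∂(Measure.pi fun _ => P) + m * r)) := by
  induction m with
  | zero =>
    rw [Measure.pi_of_empty _ (fun i => i.elim0)]
    simp
  | succ n ih =>
    set e := (MeasurableEquiv.piFinSuccAbove (fun _ : Fin (n + 1) => 𝒵) 0).symm with he
    have hmp : MeasurePreserving e (P.prod (Measure.pi fun _ : Fin n => P))
        (Measure.pi fun _ => P) :=
      (measurePreserving_piFinSuccAbove (fun _ : Fin (n + 1) => P) 0).symm
    set F : 𝒵 × (Fin n → 𝒵) → ℝ := fun q => f (e q) with hF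
    have heq : ∀ x w, e (x, w) = (Fin.cons x w : Fin (n + 1) → 𝒵) := by
      intro x w
      simp [he, MeasurableEquiv.piFinSuccAbove_symm_apply, Fin.insertNthEquiv]
    have hFm : Measurable F := hfm.comp e.measurable
    have hFi : Integrable F (P.prod (Measure.pi fun _ : Fin n => P)) :=
      (hmp.integrable_comp hf.aestronglyMeasurable).2 hf
    have hosc : ∀ w x y, |F (x, w) - F (y, w)| ≤ g x + g y := by
      intro w x y
      simp only [hF, heq]
      refine (hbd _ _ 0 ?_).trans (by simp)
      intro i hi
      obtain ⟨k, rfl⟩ := Fin.exists_succ_eq.2 hi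
      simp
    have hbdw : ∀ x w w' j, (∀ i, i ≠ j → w i = w' i) →
        |F (x, w) - F (x, w')| ≤ g (w j) + g (w' j) := by
      intro x w w' j h
      simp only [hF, heq]
      refine (hbd _ _ j.succ ?_).trans (by simp)
      intro i hi
      refine Fin.cases (by simp) (fun k hk => ?_) i hi
      simpa using h k (fun h => hk (by rw [h]))
    -- Integrability for every `w`, not just almost every one: the oscillation bound against a fixed
    -- base point dominates the section.
    have hxi : ∀ w, Integrable (fun x => F (x, w)) P := by
      intro w
      obtain ⟨x₀⟩ : Nonempty 𝒵 := nonempty_of_isProbabilityMeasure P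
      refine Integrable.mono' ((hgi.add (integrable_const (g x₀))).add
        (integrable_const |F (x₀, w)|))
        (hFm.comp (measurable_id.prodMk measurable_const)).aestronglyMeasurable
        (Filter.Eventually.of_forall fun x => ?_)
      have := hosc w x x₀
      simp only [Pi.add_apply, Real.norm_eq_abs]
      calc |F (x, w)| = |(F (x, w) - F (x₀, w)) + F (x₀, w)| := by ring_nf
        _ ≤ |F (x, w) - F (x₀, w)| + |F (x₀, w)| := abs_add_le _ _
        _ ≤ _ := by linarith
    -- Averaging out the first coordinate keeps the difference bounds in the other coordinates, so
    -- the induction hypothesis applies to `fb`; the inner integral costs one factor `exp r`.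
    set fb : (Fin n → 𝒵) → ℝ := fun w => ∫ x, F (x, w) ∂P with hfb
    have hfbm : Measurable fb := by
      have : StronglyMeasurable (fun q : (Fin n → 𝒵) × 𝒵 => F (q.2, q.1)) :=
        (hFm.comp measurable_swap).stronglyMeasurable
      exact this.integral_prod_right.measurable
    have hfbi : Integrable fb (Measure.pi fun _ => P) := hFi.integral_prod_right
    have hint : ∫ w, fb w ∂(Measure.pi fun _ => P) = ∫ z, f z ∂(Measure.pi fun _ => P) := by
      rw [← hmp.integral_comp' f]
      simp only [hfb]
      rw [← integral_prod_symm _ hFi]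
    have hb := ih fb hfbm hfbi (by
      intro w w' j h
      simp only [hfb]
      rw [← integral_sub (hxi w) (hxi w')]
      refine (abs_integral_le_integral_abs).trans ?_
      refine (integral_mono (((hxi w).sub (hxi w')).abs) (integrable_const (g (w j) + g (w' j)))
        (fun x => hbdw x w w' j h)).trans ?_
      simp)
    have hmeas : Measurable fun q => ENNReal.ofReal (Real.exp (lam * F q)) := by fun_prop
    rw [← hmp.lintegral_comp_emb e.measurableEmbedding]
    change ∫⁻ q, ENNReal.ofReal (Real.exp (lam * F q)) ∂_ ≤ _
    rw [lintegral_prod_symm _ hmeas.aemeasurable]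
    calc ∫⁻ w, ∫⁻ x, ENNReal.ofReal (Real.exp (lam * F (x, w))) ∂P ∂(Measure.pi fun _ => P)
        ≤ ∫⁻ w, ENNReal.ofReal (Real.exp r) * ENNReal.ofReal (Real.exp (lam * fb w))
            ∂(Measure.pi fun _ => P) := by
          refine lintegral_mono fun w => ?_
          refine (lintegral_exp_le_of_osc_le hgm hgi hlam hr hr0 (hxi w) (hosc w)).trans ?_
          rw [← ENNReal.ofReal_mul (Real.exp_pos _).le, ← Real.exp_add, add_comm]
      _ = ENNReal.ofReal (Real.exp r) * ∫⁻ w, ENNReal.ofReal (Real.exp (lam * fb w))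
            ∂(Measure.pi fun _ => P) := lintegral_const_mul' _ _ ENNReal.ofReal_ne_top
      _ ≤ ENNReal.ofReal (Real.exp r) * ENNReal.ofReal (Real.exp
            (lam * ∫ w, fb w ∂(Measure.pi fun _ => P) + n * r)) := by gcongr
      _ = _ := by
          rw [← ENNReal.ofReal_mul (Real.exp_pos _).le, ← Real.exp_add, hint]
          push_cast
          ring_nf

end Exponential

/-! ### Transport on the line through quantiles. -/

section Wasserstein

/-- The quantile function of a measure on the line. -/
def quantile (μ : Measure ℝ) (u : ℝ) : ℝ :=
  sInf {t | u ≤ ProbabilityTheory.cdf μ t}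

/-- Right-continuity of the distribution function makes the infimum attained. For `0 < u < 1` the
set is nonempty and bounded below, so `sInf` is not a default value. -/
lemma quantile_le_iff (μ : Measure ℝ) {u : ℝ} (h0 : 0 < u) (h1 : u < 1) (t : ℝ) :
    quantile μ u ≤ t ↔ u ≤ ProbabilityTheory.cdf μ t := by
  set F := ProbabilityTheory.cdf μ with hF
  set S : Set ℝ := {t | u ≤ F t} with hS
  have hne : S.Nonempty :=
    ((ProbabilityTheory.tendsto_cdf_atTop μ).eventually (eventually_ge_nhds h1)).exists
  have hbdd : BddBelow S := by
    obtain ⟨b, hb⟩ :=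
      ((ProbabilityTheory.tendsto_cdf_atBot μ).eventually (eventually_lt_nhds h0)).exists
    refine ⟨b, fun x hx => ?_⟩
    by_contra! hlt
    have := F.mono hlt.le
    have hx' : u ≤ F x := hx
    linarith
  constructor
  · intro h
    have hgt : ∀ y, t < y → u ≤ F y := by
      intro y hy
      obtain ⟨x, hx, hxy⟩ := exists_lt_of_csInf_lt hne (h.trans_lt hy)
      exact le_trans hx (F.mono hxy.le)
    have hc : Filter.Tendsto F (nhdsWithin t (Set.Ioi t)) (nhds (F t)) :=
      (F.right_continuous t).mono_left (nhdsWithin_mono _ Set.Ioi_subset_Ici_self)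
    exact ge_of_tendsto hc (eventually_nhdsWithin_of_forall fun y hy => hgt y hy)
  · intro h
    exact csInf_le hbdd h

lemma monotoneOn_quantile (μ : Measure ℝ) : MonotoneOn (quantile μ) (Set.Ioo 0 1) := by
  intro u hu v hv huv
  rw [quantile_le_iff μ hu.1 hu.2]
  exact huv.trans ((quantile_le_iff μ hv.1 hv.2 _).1 le_rfl)

lemma aemeasurable_quantile (μ : Measure ℝ) :
    AEMeasurable (quantile μ) (volume.restrict (Set.Ioo (0 : ℝ) 1)) :=
  aemeasurable_restrict_of_monotoneOn measurableSet_Ioo (monotoneOn_quantile μ)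

instance : IsProbabilityMeasure (volume.restrict (Set.Ioo (0 : ℝ) 1)) :=
  ⟨by simp⟩

/-- By `quantile_le_iff`, the event `quantile μ u ≤ t` is `u ≤ F t`, an interval of length `F t`. -/
lemma map_quantile (μ : Measure ℝ) [IsProbabilityMeasure μ] :
    (volume.restrict (Set.Ioo (0 : ℝ) 1)).map (quantile μ) = μ := by
  have := Measure.isProbabilityMeasure_map (aemeasurable_quantile μ)
  refine Measure.ext_of_Iic _ _ fun t => ?_
  rw [Measure.map_apply_of_aemeasurable (aemeasurable_quantile μ) measurableSet_Iic,
    Measure.restrict_apply' measurableSet_Ioo, ← ProbabilityTheory.ofReal_cdf]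
  have h1 : quantile μ ⁻¹' Set.Iic t ∩ Set.Ioo 0 1
      = Set.Iic (ProbabilityTheory.cdf μ t) ∩ Set.Ioo 0 1 := by
    ext u
    simp only [Set.mem_inter_iff, Set.mem_preimage, Set.mem_Iic, and_congr_left_iff]
    exact fun hu => quantile_le_iff μ hu.1 hu.2 t
  rw [h1]
  apply le_antisymm
  · calc _ ≤ volume (Set.Ioc (0 : ℝ) (ProbabilityTheory.cdf μ t)) :=
        measure_mono fun u hu => ⟨hu.2.1, hu.1⟩
      _ = _ := by simp
  · calc _ = volume (Set.Ioo (0 : ℝ) (ProbabilityTheory.cdf μ t)) := by simp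
      _ ≤ volume (Set.Iic (ProbabilityTheory.cdf μ t) ∩ Set.Ioo 0 1) := measure_mono fun u hu =>
        ⟨hu.2.le, hu.1, hu.2.trans_le (ProbabilityTheory.cdf_le_one μ t)⟩

/-- The indicator `1 {a ≤ t}`. -/
def step (a t : ℝ) : ℝ := if a ≤ t then 1 else 0

lemma measurable_step : Measurable fun q : ℝ × ℝ => step q.1 q.2 :=
  Measurable.ite (measurableSet_le measurable_fst measurable_snd) measurable_const
    measurable_const

lemma abs_step_sub_step (a b t : ℝ) :
    |step a t - step b t| = (Set.Ico (min a b) (max a b)).indicator (fun _ => (1 : ℝ)) t := by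
  unfold step
  simp only [Set.indicator_apply, Set.mem_Ico, min_le_iff, lt_max_iff]
  split_ifs <;> grind

lemma lintegral_abs_step_sub_step (a b : ℝ) :
    ∫⁻ t, ENNReal.ofReal |step a t - step b t| = ENNReal.ofReal |a - b| := by
  simp_rw [abs_step_sub_step]
  have : ∀ t, ENNReal.ofReal ((Set.Ico (min a b) (max a b)).indicator (fun _ => (1 : ℝ)) t)
      = (Set.Ico (min a b) (max a b)).indicator (fun _ => (1 : ℝ≥0∞)) t := by
    intro t
    by_cases h : t ∈ Set.Ico (min a b) (max a b) <;> simp [h]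
  simp_rw [this]
  rw [lintegral_indicator measurableSet_Ico]
  simp [max_sub_min_eq_abs']

/-- On the support, `t` lies between `a` and `b`, whence `t ^ 2 ≤ a ^ 2 + b ^ 2`. The weight is
chosen because its inverse is integrable in `t`. -/
lemma lintegral_abs_step_sub_step_mul_le (a b : ℝ) :
    ∫⁻ t, ENNReal.ofReal (|step a t - step b t| * (1 + t ^ 2))
      ≤ ENNReal.ofReal (|a - b| * (1 + a ^ 2 + b ^ 2)) := by
  calc ∫⁻ t, ENNReal.ofReal (|step a t - step b t| * (1 + t ^ 2))
      ≤ ∫⁻ t, ENNReal.ofReal |step a t - step b t| * ENNReal.ofReal (1 + a ^ 2 + b ^ 2) := by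
        refine lintegral_mono fun t => ?_
        rw [← ENNReal.ofReal_mul (abs_nonneg _)]
        refine ENNReal.ofReal_le_ofReal ?_
        rw [abs_step_sub_step]
        by_cases h : t ∈ Set.Ico (min a b) (max a b)
        · simp only [h, Set.indicator_of_mem, one_mul]
          obtain ⟨h1, h2⟩ := h
          rcases le_total a b with hab | hab
          · rw [min_eq_left hab] at h1
            rw [max_eq_right hab] at h2
            nlinarith [sq_nonneg a, sq_nonneg b, mul_nonneg (sub_nonneg.2 h1) (sub_nonneg.2 h2.le),
              sq_nonneg (a + b - t)]
          · rw [min_eq_right hab] at h1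
            rw [max_eq_left hab] at h2
            nlinarith [sq_nonneg a, sq_nonneg b, mul_nonneg (sub_nonneg.2 h1) (sub_nonneg.2 h2.le),
              sq_nonneg (a + b - t)]
        · simp [h]
    _ = _ := by
        rw [lintegral_mul_const' _ _ ENNReal.ofReal_ne_top, lintegral_abs_step_sub_step,
          ← ENNReal.ofReal_mul (abs_nonneg _)]

/-- The transport distance on the line is at most the `L¹` distance of distribution functions. -/
theorem wasserstein1_le_lintegral_cdf (μ ν : Measure ℝ) [IsProbabilityMeasure μ]
    [IsProbabilityMeasure ν] :
    wasserstein1 μ ν ≤ ∫⁻ t, ENNReal.ofReal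
      |ProbabilityTheory.cdf μ t - ProbabilityTheory.cdf ν t| := by
  set U : Measure ℝ := volume.restrict (Set.Ioo (0 : ℝ) 1) with hU
  have hμ : AEMeasurable (quantile μ) U := aemeasurable_quantile μ
  have hν : AEMeasurable (quantile ν) U := aemeasurable_quantile ν
  have hfst : (U.map fun u => (quantile μ u, quantile ν u)).fst = μ := by
    rw [Measure.fst_map_prodMk₀ hν, map_quantile]
  have hsnd : (U.map fun u => (quantile μ u, quantile ν u)).snd = ν := by
    rw [Measure.snd_map_prodMk₀ hμ, map_quantile]
  -- The comonotone coupling: both quantile functions evaluated at the same uniform variable.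
  refine (iInf₂_le (U.map fun u => (quantile μ u, quantile ν u)) ⟨hfst, hsnd⟩).trans ?_
  rw [lintegral_map' (by fun_prop) (hμ.prodMk hν)]
  -- Write the distance as an integral of indicators in `t`, turn `quantile ≤ t` into `u ≤ F t`, and
  -- exchange the integrals: the `u`-integral is at most the gap between the two distribution
  -- functions.
  calc ∫⁻ u, ENNReal.ofReal |quantile μ u - quantile ν u| ∂U
      = ∫⁻ u, (∫⁻ t, ENNReal.ofReal |step u (ProbabilityTheory.cdf μ t)
          - step u (ProbabilityTheory.cdf ν t)|) ∂U := by
        refine setLIntegral_congr_fun measurableSet_Ioo fun u hu => ?_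
        rw [← lintegral_abs_step_sub_step]
        refine lintegral_congr fun t => ?_
        simp only [step, quantile_le_iff μ hu.1 hu.2, quantile_le_iff ν hu.1 hu.2]
    _ = ∫⁻ t, ∫⁻ u, ENNReal.ofReal |step u (ProbabilityTheory.cdf μ t)
          - step u (ProbabilityTheory.cdf ν t)| ∂U := by
        refine lintegral_lintegral_swap (Measurable.aemeasurable ?_)
        have h1 : ∀ κ : Measure ℝ, Measurable fun q : ℝ × ℝ =>
            step q.1 (ProbabilityTheory.cdf κ q.2) := fun κ =>
          measurable_step.comp (measurable_fst.prodMk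
            ((ProbabilityTheory.monotone_cdf κ).measurable.comp measurable_snd))
        exact ((h1 μ).sub (h1 ν)).abs.ennreal_ofReal
    _ ≤ _ := by
        refine lintegral_mono fun t => ?_
        have h2 : ∀ u x y : ℝ, |step u x - step u y|
            ≤ (Set.Icc (min x y) (max x y)).indicator (fun _ => (1 : ℝ)) u := by
          intro u x y
          unfold step
          simp only [Set.indicator_apply, Set.mem_Icc, min_le_iff, le_max_iff]
          split_ifs <;> grind
        set x := ProbabilityTheory.cdf μ t
        set y := ProbabilityTheory.cdf ν t
        calc ∫⁻ u, ENNReal.ofReal |step u x - step u y| ∂U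
            ≤ ∫⁻ u, ENNReal.ofReal |step u x - step u y| :=
              setLIntegral_le_lintegral _ _
          _ ≤ ∫⁻ u, (Set.Icc (min x y) (max x y)).indicator (fun _ => (1 : ℝ≥0∞)) u := by
              refine lintegral_mono fun u => ?_
              refine (ENNReal.ofReal_le_ofReal (h2 u x y)).trans ?_
              by_cases h : u ∈ Set.Icc (min x y) (max x y) <;> simp [h]
          _ = ENNReal.ofReal |x - y| := by
              rw [lintegral_indicator measurableSet_Icc]
              simp [max_sub_min_eq_abs']

end Wasserstein

/-! ### The L¹ norm of an empirical deviation: differences, mean, exponential moment. -/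

section Deviation

variable {𝒵 E : Type*} [MeasurableSpace 𝒵] [MeasurableSpace E]

/-- The deviation of the empirical mean of `h (·, e)` from its expectation. -/
def dev (P : Measure 𝒵) (h : 𝒵 → E → ℝ) {m : ℕ} (z : Fin m → 𝒵) (e : E) : ℝ :=
  (m : ℝ)⁻¹ * ∑ j, h (z j) e - ∫ x, h x e ∂P

/-- The `L¹` norm of the deviation. -/
def devNorm (P : Measure 𝒵) (ν : Measure E) (h : 𝒵 → E → ℝ) {m : ℕ} (z : Fin m → 𝒵) : ℝ≥0∞ :=
  ∫⁻ e, ENNReal.ofReal |dev P h z e| ∂ν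

variable {P : Measure 𝒵} {ν : Measure E}
  {h : 𝒵 → E → ℝ} {g : 𝒵 → ℝ} {m : ℕ}

/-- Only the `j`-th summand changes, and it carries weight `1 / m`. This supplies the hypothesis on
differences in the exponential moment bound. -/
lemma devNorm_le_add_of_eq_off (hm : Measurable (Function.uncurry h)) (hg0 : ∀ x, 0 ≤ g x)
    (hg : ∀ x, ∫⁻ e, ENNReal.ofReal |h x e| ∂ν ≤ ENNReal.ofReal (g x)) (z z' : Fin m → 𝒵)
    (j : Fin m) (hz : ∀ i, i ≠ j → z i = z' i) :
    devNorm P ν h z ≤ devNorm P ν h z' + ENNReal.ofReal (g (z j) / m + g (z' j) / m) := by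
  have hx : ∀ x, Measurable fun e => ENNReal.ofReal |h x e| := fun x =>
    (hm.comp (measurable_const.prodMk measurable_id)).abs.ennreal_ofReal
  have hpt : ∀ e, ENNReal.ofReal |dev P h z e| ≤ ENNReal.ofReal |dev P h z' e| +
      ENNReal.ofReal ((m : ℝ)⁻¹) * (ENNReal.ofReal |h (z j) e| + ENNReal.ofReal |h (z' j) e|) := by
    intro e
    rw [← ENNReal.ofReal_add (abs_nonneg _) (abs_nonneg _), ← ENNReal.ofReal_mul (by positivity),
      ← ENNReal.ofReal_add (abs_nonneg _) (by positivity)]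
    refine ENNReal.ofReal_le_ofReal ?_
    have hs : ∑ i, h (z i) e - ∑ i, h (z' i) e = h (z j) e - h (z' j) e := by
      rw [← Finset.sum_sub_distrib]
      refine Finset.sum_eq_single_of_mem j (Finset.mem_univ _) fun i _ hi => ?_
      rw [hz i hi, sub_self]
    have hd : dev P h z e = dev P h z' e + (m : ℝ)⁻¹ * (h (z j) e - h (z' j) e) := by
      rw [← hs]; unfold dev; ring
    rw [hd]
    refine (abs_add_le _ _).trans ?_
    rw [abs_mul, abs_of_nonneg (by positivity : (0 : ℝ) ≤ (m : ℝ)⁻¹)]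
    gcongr
    exact abs_sub _ _
  calc devNorm P ν h z
      ≤ ∫⁻ e, (ENNReal.ofReal |dev P h z' e| + ENNReal.ofReal ((m : ℝ)⁻¹)
        * (ENNReal.ofReal |h (z j) e| + ENNReal.ofReal |h (z' j) e|)) ∂ν := lintegral_mono hpt
    _ = devNorm P ν h z' + ENNReal.ofReal ((m : ℝ)⁻¹) * (∫⁻ e, ENNReal.ofReal |h (z j) e| ∂ν
        + ∫⁻ e, ENNReal.ofReal |h (z' j) e| ∂ν) := by
        have h2 : Measurable fun e => ENNReal.ofReal ((m : ℝ)⁻¹)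
            * (ENNReal.ofReal |h (z j) e| + ENNReal.ofReal |h (z' j) e|) :=
          ((hx _).add (hx _)).const_mul _
        rw [lintegral_add_right _ h2,
          lintegral_const_mul' _ _ ENNReal.ofReal_ne_top, lintegral_add_left (hx _)]
        rfl
    _ ≤ devNorm P ν h z' + ENNReal.ofReal ((m : ℝ)⁻¹)
        * (ENNReal.ofReal (g (z j)) + ENNReal.ofReal (g (z' j))) := by
        gcongr <;> exact hg _
    _ = _ := by
        rw [← ENNReal.ofReal_add (hg0 _) (hg0 _), ← ENNReal.ofReal_mul (by positivity)]
        congr 2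
        ring

variable [IsProbabilityMeasure P]

lemma measurable_dev (hm : Measurable (Function.uncurry h)) :
    Measurable fun q : (Fin m → 𝒵) × E => dev P h q.1 q.2 := by
  unfold dev
  refine Measurable.sub (Measurable.const_mul (Finset.measurable_sum _ fun j _ => ?_) _) ?_
  · have h1 : Measurable fun q : (Fin m → 𝒵) × E => (q.1 j, q.2) := by fun_prop
    exact hm.comp h1
  · have h1 : StronglyMeasurable fun q : E × 𝒵 => h q.2 q.1 :=
      (hm.comp measurable_swap).stronglyMeasurable
    exact h1.integral_prod_right'.measurable.comp measurable_snd

lemma integrable_of_abs_le_one (hm : Measurable (Function.uncurry h))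
    (h1 : ∀ x e, |h x e| ≤ 1) (e : E) : Integrable (fun x => h x e) P :=
  Integrable.of_bound (hm.comp (measurable_id.prodMk measurable_const)).aestronglyMeasurable 1
    (Filter.Eventually.of_forall fun x => h1 x e)

lemma devNorm_add_le {h' : 𝒵 → E → ℝ} (hm : Measurable (Function.uncurry h))
    (hm' : Measurable (Function.uncurry h'))
    (h1 : ∀ x e, |h x e| ≤ 1) (h1' : ∀ x e, |h' x e| ≤ 1) (z : Fin m → 𝒵) :
    devNorm P ν (fun x e => h x e + h' x e) z ≤ devNorm P ν h z + devNorm P ν h' z := by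
  unfold devNorm
  have hd : Measurable fun e => ENNReal.ofReal |dev P h z e| :=
    ((measurable_dev hm).comp (measurable_const.prodMk measurable_id)).abs.ennreal_ofReal
  rw [← lintegral_add_left hd]
  refine lintegral_mono fun e => ?_
  rw [← ENNReal.ofReal_add (abs_nonneg _) (abs_nonneg _)]
  refine ENNReal.ofReal_le_ofReal ?_
  have : dev P (fun x e => h x e + h' x e) z e = dev P h z e + dev P h' z e := by
    simp only [dev]
    rw [integral_add (integrable_of_abs_le_one hm h1 e) (integrable_of_abs_le_one hm' h1' e),
      Finset.sum_add_distrib]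
    ring
  rw [this]
  exact abs_add_le _ _

variable [SFinite ν]

lemma measurable_devNorm (hm : Measurable (Function.uncurry h)) :
    Measurable fun z : Fin m → 𝒵 => devNorm P ν h z :=
  (measurable_dev hm).abs.ennreal_ofReal.lintegral_prod_right'

lemma lintegral_abs_integral_le (hm : Measurable (Function.uncurry h))
    (h1 : ∀ x e, |h x e| ≤ 1) (hg0 : ∀ x, 0 ≤ g x) (hgi : Integrable g P)
    (hg : ∀ x, ∫⁻ e, ENNReal.ofReal |h x e| ∂ν ≤ ENNReal.ofReal (g x)) :
    ∫⁻ e, ENNReal.ofReal |∫ x, h x e ∂P| ∂ν ≤ ENNReal.ofReal (∫ x, g x ∂P) := by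
  calc ∫⁻ e, ENNReal.ofReal |∫ x, h x e ∂P| ∂ν
      ≤ ∫⁻ e, ∫⁻ x, ENNReal.ofReal |h x e| ∂P ∂ν := by
        refine lintegral_mono fun e => ?_
        rw [← ofReal_integral_eq_lintegral_ofReal (integrable_of_abs_le_one hm h1 e).abs
          (Filter.Eventually.of_forall fun x => abs_nonneg _)]
        exact ENNReal.ofReal_le_ofReal abs_integral_le_integral_abs
    _ = ∫⁻ x, ∫⁻ e, ENNReal.ofReal |h x e| ∂ν ∂P :=
        lintegral_lintegral_swap (hm.comp measurable_swap).abs.ennreal_ofReal.aemeasurable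
    _ ≤ ∫⁻ x, ENNReal.ofReal (g x) ∂P := lintegral_mono hg
    _ = _ := by
        rw [ofReal_integral_eq_lintegral_ofReal hgi (Filter.Eventually.of_forall hg0)]

/-- The crude triangle-inequality bound, without cancellation. It gives finiteness, and it handles
the error below the finest net. -/
lemma devNorm_le (hm : Measurable (Function.uncurry h))
    (h1 : ∀ x e, |h x e| ≤ 1) (hg0 : ∀ x, 0 ≤ g x) (hgi : Integrable g P)
    (hg : ∀ x, ∫⁻ e, ENNReal.ofReal |h x e| ∂ν ≤ ENNReal.ofReal (g x)) (z : Fin m → 𝒵) :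
    devNorm P ν h z ≤ ENNReal.ofReal ((m : ℝ)⁻¹ * ∑ j, g (z j) + ∫ x, g x ∂P) := by
  have hj : ∀ j, Measurable fun e => ENNReal.ofReal |h (z j) e| := fun j =>
    (hm.comp (measurable_const.prodMk measurable_id)).abs.ennreal_ofReal
  have hpt : ∀ e, ENNReal.ofReal |dev P h z e|
      ≤ ENNReal.ofReal ((m : ℝ)⁻¹) * ∑ j, ENNReal.ofReal |h (z j) e|
        + ENNReal.ofReal |∫ x, h x e ∂P| := by
    intro e
    rw [← ENNReal.ofReal_sum_of_nonneg (fun j _ => abs_nonneg _),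
      ← ENNReal.ofReal_mul (by positivity), ← ENNReal.ofReal_add (by positivity) (abs_nonneg _)]
    refine ENNReal.ofReal_le_ofReal ?_
    unfold dev
    refine (abs_sub _ _).trans ?_
    gcongr
    rw [abs_mul, abs_of_nonneg (by positivity : (0 : ℝ) ≤ (m : ℝ)⁻¹)]
    gcongr
    exact Finset.abs_sum_le_sum_abs _ _
  calc devNorm P ν h z
      ≤ ∫⁻ e, (ENNReal.ofReal ((m : ℝ)⁻¹) * ∑ j, ENNReal.ofReal |h (z j) e|
        + ENNReal.ofReal |∫ x, h x e ∂P|) ∂ν := lintegral_mono hpt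
    _ = ENNReal.ofReal ((m : ℝ)⁻¹) * ∑ j, ∫⁻ e, ENNReal.ofReal |h (z j) e| ∂ν
        + ∫⁻ e, ENNReal.ofReal |∫ x, h x e ∂P| ∂ν := by
        rw [lintegral_add_left (Measurable.const_mul
            (Finset.measurable_sum _ fun j _ => hj j) _),
          lintegral_const_mul' _ _ ENNReal.ofReal_ne_top, lintegral_finsetSum _ fun j _ => hj j]
    _ ≤ ENNReal.ofReal ((m : ℝ)⁻¹) * ∑ j, ENNReal.ofReal (g (z j))
        + ENNReal.ofReal (∫ x, g x ∂P) := by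
        gcongr with j
        · exact hg _
        · exact lintegral_abs_integral_le hm h1 hg0 hgi hg
    _ = _ := by
        rw [← ENNReal.ofReal_sum_of_nonneg (fun j _ => hg0 _),
          ← ENNReal.ofReal_mul (by positivity), ← ENNReal.ofReal_add
            (mul_nonneg (by positivity) (Finset.sum_nonneg fun j _ => hg0 _))
            (integral_nonneg hg0)]

/-- Independence divides the variance by `m`, and `|h| ≤ 1` gives `h ^ 2 ≤ |h|`. Keeping the mean of
`|h|` lets the bound shrink as two maps approach each other. -/
lemma lintegral_dev_sq_le (hmpos : 0 < m) (hm : Measurable (Function.uncurry h))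
    (h1 : ∀ x e, |h x e| ≤ 1) (e : E) :
    ∫⁻ z : Fin m → 𝒵, ENNReal.ofReal (dev P h z e ^ 2) ∂(Measure.pi fun _ => P)
      ≤ ENNReal.ofReal ((m : ℝ)⁻¹ * ∫ x, |h x e| ∂P) := by
  set X : 𝒵 → ℝ := fun x => h x e with hX
  have hXm : Measurable X := hm.comp (measurable_id.prodMk measurable_const)
  have hX2 : MemLp X 2 P := MemLp.of_bound hXm.aestronglyMeasurable 1
    (Filter.Eventually.of_forall fun x => h1 x e)
  have hXi : Integrable X P := integrable_of_abs_le_one hm h1 e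
  have hm0 : (m : ℝ) ≠ 0 := by positivity
  set S : (Fin m → 𝒵) → ℝ := ∑ j, fun z : Fin m → 𝒵 => X (z j) with hS
  have hSj : ∀ j : Fin m, MemLp (fun z : Fin m → 𝒵 => X (z j)) 2 (Measure.pi fun _ => P) :=
    fun j => hX2.comp_measurePreserving (measurePreserving_eval _ j)
  have hS2 : MemLp S 2 (Measure.pi fun _ => P) := memLp_finsetSum' _ fun j _ => hSj j
  have hES : ∫ z, S z ∂(Measure.pi fun _ => P) = m * ∫ x, X x ∂P := by
    simp only [hS, Finset.sum_apply]
    rw [integral_finsetSum _ fun j _ => (hSj j).integrable one_le_two]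
    have : ∀ j : Fin m, ∫ z : Fin m → 𝒵, X (z j) ∂(Measure.pi fun _ => P) = ∫ x, X x ∂P :=
      fun j => integral_comp_eval (μ := fun _ : Fin m => P) hXm.aestronglyMeasurable
    simp [this]
  have hvar : ProbabilityTheory.variance S (Measure.pi fun _ => P)
      = m * ProbabilityTheory.variance X P := by
    rw [hS, ProbabilityTheory.variance_sum_pi (fun _ => hX2)]
    simp
  have hd : ∀ z : Fin m → 𝒵, dev P h z e = (m : ℝ)⁻¹ * (S z - ∫ z, S z ∂(Measure.pi fun _ => P)) := by
    intro z
    rw [hES]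
    simp only [dev, hS, Finset.sum_apply]
    field_simp
    simp [hX]
  have hi : Integrable (fun z => (S z - ∫ z, S z ∂(Measure.pi fun _ => P)) ^ 2)
      (Measure.pi fun _ => P) := (hS2.sub (memLp_const _)).integrable_sq
  rw [← ofReal_integral_eq_lintegral_ofReal]
  · refine ENNReal.ofReal_le_ofReal ?_
    simp_rw [hd, mul_pow]
    rw [integral_const_mul, ← ProbabilityTheory.variance_eq_integral hS2.1.aemeasurable, hvar]
    have h2 : ProbabilityTheory.variance X P ≤ ∫ x, |h x e| ∂P := by
      refine (ProbabilityTheory.variance_le_expectation_sq hXm.aestronglyMeasurable).trans ?_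
      refine integral_mono hX2.integrable_sq hXi.abs fun x => ?_
      simp only [Pi.pow_apply, hX]
      rw [← sq_abs]
      nlinarith [h1 x e, abs_nonneg (h x e)]
    calc (m : ℝ)⁻¹ ^ 2 * (m * ProbabilityTheory.variance X P)
        = (m : ℝ)⁻¹ * ProbabilityTheory.variance X P := by field_simp
      _ ≤ _ := by gcongr
  · simp_rw [hd, mul_pow]
    exact hi.const_mul _
  · exact Filter.Eventually.of_forall fun z => sq_nonneg _

/-- Uses `|y| ≤ α y² + α⁻¹` in place of Cauchy–Schwarz; the free `α` may then be chosen separately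
for each `e`. -/
lemma lintegral_abs_dev_le (hmpos : 0 < m) (hm : Measurable (Function.uncurry h))
    (h1 : ∀ x e, |h x e| ≤ 1) (e : E) {α : ℝ} (hα : 0 < α) :
    ∫⁻ z : Fin m → 𝒵, ENNReal.ofReal |dev P h z e| ∂(Measure.pi fun _ => P)
      ≤ ENNReal.ofReal (α * ((m : ℝ)⁻¹ * ∫ x, |h x e| ∂P) + α⁻¹) := by
  have hpt : ∀ y : ℝ, |y| ≤ α * y ^ 2 + α⁻¹ := by
    intro y
    have h2 : α * α⁻¹ = 1 := mul_inv_cancel₀ hα.ne'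
    have h3 : 0 < α⁻¹ := by positivity
    rw [← sq_abs]
    have h4 : 0 ≤ α⁻¹ * (α * |y| - 1) ^ 2 := by positivity
    have h5 : α⁻¹ * (α * |y| - 1) ^ 2 = α * |y| ^ 2 - 2 * |y| + α⁻¹ := by
      field_simp
      ring
    linarith [abs_nonneg y]
  have hv : 0 ≤ ∫ x, |h x e| ∂P := integral_nonneg fun _ => abs_nonneg _
  calc ∫⁻ z : Fin m → 𝒵, ENNReal.ofReal |dev P h z e| ∂(Measure.pi fun _ => P)
      ≤ ∫⁻ z : Fin m → 𝒵, (ENNReal.ofReal α * ENNReal.ofReal (dev P h z e ^ 2)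
        + ENNReal.ofReal α⁻¹) ∂(Measure.pi fun _ => P) := by
        refine lintegral_mono fun z => ?_
        rw [← ENNReal.ofReal_mul hα.le, ← ENNReal.ofReal_add (by positivity) (by positivity)]
        exact ENNReal.ofReal_le_ofReal (hpt _)
    _ = ENNReal.ofReal α * ∫⁻ z : Fin m → 𝒵, ENNReal.ofReal (dev P h z e ^ 2)
        ∂(Measure.pi fun _ => P) + ENNReal.ofReal α⁻¹ := by
        rw [lintegral_add_right _ measurable_const,
          lintegral_const_mul' _ _ ENNReal.ofReal_ne_top]
        simp
    _ ≤ ENNReal.ofReal α * ENNReal.ofReal ((m : ℝ)⁻¹ * ∫ x, |h x e| ∂P)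
        + ENNReal.ofReal α⁻¹ := by
        gcongr
        exact lintegral_dev_sq_le hmpos hm h1 e
    _ = _ := by
        rw [← ENNReal.ofReal_mul hα.le, ← ENNReal.ofReal_add (by positivity) (by positivity)]

/-- Bound on the mean of the `L¹` deviation in terms of a weight `w` on the index space. -/
lemma lintegral_devNorm_le (hmpos : 0 < m) (hm : Measurable (Function.uncurry h))
    (h1 : ∀ x e, |h x e| ≤ 1) {w : E → ℝ} (hwm : Measurable w) (hw : ∀ e, 0 < w e)
    {a A B : ℝ} (ha : 0 < a) (hA0 : 0 ≤ A) (hB0 : 0 ≤ B)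
    (hA : ∫⁻ x, ∫⁻ e, ENNReal.ofReal (|h x e| * w e) ∂ν ∂P ≤ ENNReal.ofReal A)
    (hB : ∫⁻ e, ENNReal.ofReal (w e)⁻¹ ∂ν ≤ ENNReal.ofReal B) :
    ∫⁻ z : Fin m → 𝒵, devNorm P ν h z ∂(Measure.pi fun _ => P)
      ≤ ENNReal.ofReal ((√m)⁻¹ * (a * A + a⁻¹ * B)) := by
  have hsq : 0 < √(m : ℝ) := Real.sqrt_pos.2 (by exact_mod_cast hmpos)
  have hss : √(m : ℝ) * √m = m := Real.mul_self_sqrt (by positivity)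
  have hpt : ∀ e, ∫⁻ z : Fin m → 𝒵, ENNReal.ofReal |dev P h z e| ∂(Measure.pi fun _ => P)
      ≤ ENNReal.ofReal ((√m)⁻¹ * a) * ∫⁻ x, ENNReal.ofReal (|h x e| * w e) ∂P
        + ENNReal.ofReal ((√m)⁻¹ * a⁻¹) * ENNReal.ofReal (w e)⁻¹ := by
    intro e
    have hwe := hw e
    -- With this `α` both terms carry `(√m)⁻¹`, one weighted by `w e` and the other by its inverse.
    refine (lintegral_abs_dev_le hmpos hm h1 e (α := √m * a * w e) (by positivity)).trans ?_
    rw [← ofReal_integral_eq_lintegral_ofReal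
      ((integrable_of_abs_le_one hm h1 e).abs.mul_const _)
      (Filter.Eventually.of_forall fun x => by positivity), integral_mul_const]
    have hv : 0 ≤ ∫ x, |h x e| ∂P := integral_nonneg fun _ => abs_nonneg _
    rw [← ENNReal.ofReal_mul (by positivity), ← ENNReal.ofReal_mul (by positivity),
      ← ENNReal.ofReal_add (by positivity) (by positivity)]
    refine ENNReal.ofReal_le_ofReal (le_of_eq ?_)
    have h3 : (m : ℝ)⁻¹ = (√m)⁻¹ * (√m)⁻¹ := by rw [← hss, mul_inv]; simp
    rw [h3]
    field_simp
  unfold devNorm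
  rw [lintegral_lintegral_swap (measurable_dev hm).abs.ennreal_ofReal.aemeasurable]
  have hmw : Measurable fun q : E × 𝒵 => ENNReal.ofReal (|h q.2 q.1| * w q.1) :=
    ((hm.comp measurable_swap).abs.mul (hwm.comp measurable_fst)).ennreal_ofReal
  calc ∫⁻ e, ∫⁻ z : Fin m → 𝒵, ENNReal.ofReal |dev P h z e| ∂(Measure.pi fun _ => P) ∂ν
      ≤ ∫⁻ e, (ENNReal.ofReal ((√m)⁻¹ * a) * ∫⁻ x, ENNReal.ofReal (|h x e| * w e) ∂P
        + ENNReal.ofReal ((√m)⁻¹ * a⁻¹) * ENNReal.ofReal (w e)⁻¹) ∂ν := lintegral_mono hpt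
    _ = ENNReal.ofReal ((√m)⁻¹ * a) * ∫⁻ x, ∫⁻ e, ENNReal.ofReal (|h x e| * w e) ∂ν ∂P
        + ENNReal.ofReal ((√m)⁻¹ * a⁻¹) * ∫⁻ e, ENNReal.ofReal (w e)⁻¹ ∂ν := by
        have h2 : Measurable fun e =>
            ENNReal.ofReal ((√m)⁻¹ * a⁻¹) * ENNReal.ofReal (w e)⁻¹ := by fun_prop
        rw [lintegral_add_right _ h2,
          lintegral_const_mul' _ _ ENNReal.ofReal_ne_top,
          lintegral_const_mul' _ _ ENNReal.ofReal_ne_top,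
          lintegral_lintegral_swap hmw.aemeasurable]
    _ ≤ ENNReal.ofReal ((√m)⁻¹ * a) * ENNReal.ofReal A
        + ENNReal.ofReal ((√m)⁻¹ * a⁻¹) * ENNReal.ofReal B := by gcongr
    _ = _ := by
        rw [← ENNReal.ofReal_mul (by positivity), ← ENNReal.ofReal_mul (by positivity),
          ← ENNReal.ofReal_add (by positivity) (by positivity)]
        congr 1
        ring

/-- Exponential moment of the `L¹` deviation. -/
theorem lintegral_exp_devNorm_le (hmpos : 0 < m) (hm : Measurable (Function.uncurry h))
    (h1 : ∀ x e, |h x e| ≤ 1) (hg0 : ∀ x, 0 ≤ g x) (hgm : Measurable g) (hgi : Integrable g P)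
    (hg : ∀ x, ∫⁻ e, ENNReal.ofReal |h x e| ∂ν ≤ ENNReal.ofReal (g x))
    {s A W : ℝ} (hs : 0 ≤ s) (hsm : s ≤ √m) (hA0 : 0 ≤ A) (hW0 : 0 ≤ W)
    (hA : ∫⁻ z : Fin m → 𝒵, devNorm P ν h z ∂(Measure.pi fun _ => P)
      ≤ ENNReal.ofReal ((√m)⁻¹ * A))
    (hW : ∫⁻ x, ENNReal.ofReal ((g x + ∫ y, g y ∂P) ^ 2 * Real.exp (g x + ∫ y, g y ∂P)) ∂P
      ≤ ENNReal.ofReal W) :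
    ∫⁻ z : Fin m → 𝒵, ENNReal.ofReal (Real.exp (s * (√m * (devNorm P ν h z).toReal)))
        ∂(Measure.pi fun _ => P)
      ≤ ENNReal.ofReal (Real.exp (s * A + s ^ 2 * W)) := by
  have hsq : 0 < √(m : ℝ) := Real.sqrt_pos.2 (by exact_mod_cast hmpos)
  have hss : √(m : ℝ) * √m = m := Real.mul_self_sqrt (by positivity)
  have hmr : (0 : ℝ) < m := by exact_mod_cast hmpos
  set c := ∫ y, g y ∂P with hc
  have hc0 : 0 ≤ c := integral_nonneg hg0
  have hfin : ∀ z : Fin m → 𝒵, devNorm P ν h z ≠ ∞ := fun z =>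
    ((devNorm_le hm h1 hg0 hgi hg z).trans_lt ENNReal.ofReal_lt_top).ne
  set f : (Fin m → 𝒵) → ℝ := fun z => (devNorm P ν h z).toReal with hf
  have hfm : Measurable f := (measurable_devNorm hm).ennreal_toReal
  have hf0 : ∀ z, 0 ≤ f z := fun z => ENNReal.toReal_nonneg
  have hof : ∀ z, ENNReal.ofReal (f z) = devNorm P ν h z := fun z => ENNReal.ofReal_toReal (hfin z)
  have hfi : Integrable f (Measure.pi fun _ => P) := by
    refine ⟨hfm.aestronglyMeasurable, ?_⟩
    rw [hasFiniteIntegral_iff_ofReal (Filter.Eventually.of_forall hf0)]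
    simp_rw [hof]
    exact hA.trans_lt ENNReal.ofReal_lt_top
  have hEf : ∫ z, f z ∂(Measure.pi fun _ => P) ≤ (√m)⁻¹ * A := by
    rw [integral_eq_lintegral_of_nonneg_ae (Filter.Eventually.of_forall hf0)
      hfm.aestronglyMeasurable]
    simp_rw [hof]
    exact ENNReal.toReal_le_of_le_ofReal (by positivity) hA
  have hone : ∀ z z' : Fin m → 𝒵, ∀ j, (∀ i, i ≠ j → z i = z' i) →
      f z - f z' ≤ g (z j) / m + g (z' j) / m := by
    intro z z' j hz
    have h2 := devNorm_le_add_of_eq_off (P := P) hm hg0 hg z z' j hz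
    have h3 : 0 ≤ g (z j) / m + g (z' j) / m :=
      add_nonneg (div_nonneg (hg0 _) hmr.le) (div_nonneg (hg0 _) hmr.le)
    rw [← hof, ← hof, ← ENNReal.ofReal_add (hf0 _) h3] at h2
    have := (ENNReal.ofReal_le_ofReal_iff (add_nonneg (hf0 _) h3)).1 h2
    linarith
  have hcm : ∫ y, g y / m ∂P = c / m := integral_div _ _
  -- Since `s ≤ √m`, the factor `s / √m` may be dropped inside the exponential and kept in the
  -- square. The `m` coordinates then contribute `s ^ 2 * W` in total.
  have hrpt : ∀ x, (s * √m * (g x / m + c / m)) ^ 2 * Real.exp (s * √m * (g x / m + c / m))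
      ≤ s ^ 2 / m * ((g x + c) ^ 2 * Real.exp (g x + c)) := by
    intro x
    have hG : 0 ≤ g x + c := add_nonneg (hg0 x) hc0
    have h2 : s * √m * (g x / m + c / m) = s / √m * (g x + c) := by
      rw [← add_div]
      nth_rewrite 2 [← hss]
      field_simp
    have h3 : s / √m ≤ 1 := (div_le_one hsq).2 hsm
    have h4 : s / √m * (g x + c) ≤ g x + c := mul_le_of_le_one_left hG h3
    rw [h2, mul_pow, div_pow, Real.sq_sqrt hmr.le, mul_assoc]
    gcongr
  have hr : ∫⁻ x, ENNReal.ofReal ((s * √m * (g x / m + ∫ y, g y / m ∂P)) ^ 2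
      * Real.exp (s * √m * (g x / m + ∫ y, g y / m ∂P))) ∂P
      ≤ ENNReal.ofReal (s ^ 2 / m * W) := by
    rw [hcm, ENNReal.ofReal_mul (by positivity)]
    calc _ ≤ ∫⁻ x, ENNReal.ofReal (s ^ 2 / m)
          * ENNReal.ofReal ((g x + c) ^ 2 * Real.exp (g x + c)) ∂P := by
          refine lintegral_mono fun x => ?_
          rw [← ENNReal.ofReal_mul (by positivity)]
          exact ENNReal.ofReal_le_ofReal (hrpt x)
      _ ≤ _ := by
          rw [lintegral_const_mul' _ _ ENNReal.ofReal_ne_top]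
          gcongr
  have key := lintegral_exp_le_of_bounded_differences (P := P) (g := fun x => g x / m)
    (lam := s * √m) (hgm.div_const _) (hgi.div_const _) (by positivity) hr (by positivity) m f hfm
    hfi (by
      intro z z' j hz
      rw [abs_sub_le_iff]
      refine ⟨hone z z' j hz, ?_⟩
      have := hone z' z j (fun i hi => (hz i hi).symm)
      linarith)
  calc _ = ∫⁻ z : Fin m → 𝒵, ENNReal.ofReal (Real.exp (s * √m * f z))
        ∂(Measure.pi fun _ => P) := by simp only [hf, mul_assoc]
    _ ≤ _ := key
    _ ≤ _ := by
        refine ENNReal.ofReal_le_ofReal (Real.exp_le_exp.2 ?_)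
        have h5 : s * √m * ∫ z, f z ∂(Measure.pi fun _ => P) ≤ s * √m * ((√m)⁻¹ * A) := by
          gcongr
        have h6 : s * √m * ((√m)⁻¹ * A) = s * A := by field_simp
        have h7 : (m : ℝ) * (s ^ 2 / m * W) = s ^ 2 * W := by field_simp
        linarith

end Deviation

/-! ### Half-space indicators indexed by directions and thresholds. -/

section Slices

/-- An inequality, since the sphere is empty for `p = 0`; every later average needs only this
direction. -/
lemma sphereUniform_univ_le_one (p : ℕ) : sphereUniform p Set.univ ≤ 1 := by
  simp only [sphereUniform, Measure.smul_apply, smul_eq_mul]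
  exact ENNReal.inv_mul_le_one _

instance (p : ℕ) : IsFiniteMeasure (sphereUniform p) :=
  ⟨(sphereUniform_univ_le_one p).trans_lt ENNReal.one_lt_top⟩

/-- The measure on directions and thresholds. -/
abbrev sliceMeasure (p : ℕ) :
    Measure (Metric.sphere (0 : EuclideanSpace ℝ (Fin p)) 1 × ℝ) :=
  (sphereUniform p).prod volume

variable {𝒵 : Type*} {p : ℕ}

/-- The indicator of `⟨ω, T x⟩ ≤ t` as a function of `x` and `(ω, t)`. -/
def slice (T : 𝒵 → EuclideanSpace ℝ (Fin p)) (x : 𝒵)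
    (e : Metric.sphere (0 : EuclideanSpace ℝ (Fin p)) 1 × ℝ) : ℝ :=
  step (inner ℝ (e.1 : EuclideanSpace ℝ (Fin p)) (T x)) e.2

/-- The difference of the slices of two maps. -/
def sliceDiff (T T' : 𝒵 → EuclideanSpace ℝ (Fin p)) (x : 𝒵)
    (e : Metric.sphere (0 : EuclideanSpace ℝ (Fin p)) 1 × ℝ) : ℝ :=
  slice T x e - slice T' x e

lemma abs_sliceDiff_le_one (T T' : 𝒵 → EuclideanSpace ℝ (Fin p)) (x : 𝒵)
    (e : Metric.sphere (0 : EuclideanSpace ℝ (Fin p)) 1 × ℝ) : |sliceDiff T T' x e| ≤ 1 := by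
  unfold sliceDiff slice
  rw [abs_step_sub_step]
  exact Set.indicator_le_self' (fun _ _ => zero_le_one) _

lemma abs_inner_sphere_le (ω : Metric.sphere (0 : EuclideanSpace ℝ (Fin p)) 1)
    (v : EuclideanSpace ℝ (Fin p)) : |inner ℝ (ω : EuclideanSpace ℝ (Fin p)) v| ≤ ‖v‖ := by
  refine (abs_real_inner_le_norm _ _).trans ?_
  rw [norm_eq_of_mem_sphere ω, one_mul]

lemma lintegral_sphereUniform_le {F : Metric.sphere (0 : EuclideanSpace ℝ (Fin p)) 1 → ℝ≥0∞}
    {c : ℝ≥0∞} (h : ∀ ω, F ω ≤ c) : ∫⁻ ω, F ω ∂(sphereUniform p) ≤ c :=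
  calc ∫⁻ ω, F ω ∂(sphereUniform p) ≤ ∫⁻ _, c ∂(sphereUniform p) := lintegral_mono h
    _ = c * sphereUniform p Set.univ := lintegral_const _
    _ ≤ c := mul_le_of_le_one_right' (sphereUniform_univ_le_one p)

variable [MeasurableSpace 𝒵]

lemma measurable_slice {T : 𝒵 → EuclideanSpace ℝ (Fin p)} (hT : Measurable T) :
    Measurable (Function.uncurry (slice T)) := by
  have h1 : Measurable fun q : 𝒵 × (Metric.sphere (0 : EuclideanSpace ℝ (Fin p)) 1 × ℝ) =>
      (inner ℝ (q.2.1 : EuclideanSpace ℝ (Fin p)) (T q.1), q.2.2) := by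
    refine Measurable.prodMk (Measurable.inner ?_ ?_) (by fun_prop)
    · exact measurable_subtype_coe.comp (measurable_fst.comp measurable_snd)
    · exact hT.comp measurable_fst
  exact measurable_step.comp h1

lemma measurable_sliceDiff {T T' : 𝒵 → EuclideanSpace ℝ (Fin p)} (hT : Measurable T)
    (hT' : Measurable T') : Measurable (Function.uncurry (sliceDiff T T')) :=
  (measurable_slice hT).sub (measurable_slice hT')

lemma lintegral_abs_sliceDiff_le {T T' : 𝒵 → EuclideanSpace ℝ (Fin p)} (hT : Measurable T)
    (hT' : Measurable T') (x : 𝒵) :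
    ∫⁻ e, ENNReal.ofReal |sliceDiff T T' x e| ∂(sliceMeasure p)
      ≤ ENNReal.ofReal ‖T x - T' x‖ := by
  have hm : Measurable fun e => ENNReal.ofReal |sliceDiff T T' x e| :=
    ((measurable_sliceDiff hT hT').comp
      (measurable_const.prodMk measurable_id)).abs.ennreal_ofReal
  rw [lintegral_prod _ hm.aemeasurable]
  refine lintegral_sphereUniform_le fun ω => ?_
  simp only [sliceDiff, slice]
  rw [lintegral_abs_step_sub_step, ← inner_sub_right]
  exact ENNReal.ofReal_le_ofReal (abs_inner_sphere_le ω _)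

lemma lintegral_abs_sliceDiff_mul_le {T T' : 𝒵 → EuclideanSpace ℝ (Fin p)} (hT : Measurable T)
    (hT' : Measurable T') (x : 𝒵) :
    ∫⁻ e, ENNReal.ofReal (|sliceDiff T T' x e| * (1 + e.2 ^ 2)) ∂(sliceMeasure p)
      ≤ ENNReal.ofReal (‖T x - T' x‖ * (1 + ‖T x‖ ^ 2 + ‖T' x‖ ^ 2)) := by
  have hd : Measurable (sliceDiff T T' x) := (measurable_sliceDiff hT hT').of_uncurry_left
  have hm : Measurable fun e : Metric.sphere (0 : EuclideanSpace ℝ (Fin p)) 1 × ℝ =>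
      ENNReal.ofReal (|sliceDiff T T' x e| * (1 + e.2 ^ 2)) :=
    (hd.abs.mul ((measurable_snd.pow_const 2).const_add 1)).ennreal_ofReal
  rw [lintegral_prod _ hm.aemeasurable]
  refine lintegral_sphereUniform_le fun ω => ?_
  simp only [sliceDiff, slice]
  refine (lintegral_abs_step_sub_step_mul_le _ _).trans (ENNReal.ofReal_le_ofReal ?_)
  rw [← inner_sub_right]
  have h1 := abs_inner_sphere_le ω (T x)
  have h2 := abs_inner_sphere_le ω (T' x)
  have h3 := abs_inner_sphere_le ω (T x - T' x)
  rw [← sq_abs (inner ℝ (ω : EuclideanSpace ℝ (Fin p)) (T x)),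
    ← sq_abs (inner ℝ (ω : EuclideanSpace ℝ (Fin p)) (T' x))]
  gcongr

lemma lintegral_inv_one_add_sq_le (p : ℕ) :
    ∫⁻ e, ENNReal.ofReal (1 + e.2 ^ 2)⁻¹ ∂(sliceMeasure p) ≤ ENNReal.ofReal Real.pi := by
  rw [lintegral_prod _ (by fun_prop)]
  refine lintegral_sphereUniform_le fun ω => ?_
  rw [← ofReal_integral_eq_lintegral_ofReal integrable_inv_one_add_sq
    (Filter.Eventually.of_forall fun t => by positivity), integral_univ_inv_one_add_sq]

end Slices

/-! ### Increments between two maps at scale β. -/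

section Pair

variable {𝒵 : Type*} [MeasurableSpace 𝒵] {P : Measure 𝒵} {p : ℕ}

lemma lintegral_ofReal_le_of_le {F R : 𝒵 → ℝ} {b : ℝ} (hF : ∀ x, 0 ≤ F x) (h : ∀ x, F x ≤ R x)
    (hR : Integrable R P) (hb : ∫ x, R x ∂P ≤ b) :
    ∫⁻ x, ENNReal.ofReal (F x) ∂P ≤ ENNReal.ofReal b :=
  calc ∫⁻ x, ENNReal.ofReal (F x) ∂P ≤ ∫⁻ x, ENNReal.ofReal (R x) ∂P :=
        lintegral_mono fun x => ENNReal.ofReal_le_ofReal (h x)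
    _ = ENNReal.ofReal (∫ x, R x ∂P) := by
        rw [ofReal_integral_eq_lintegral_ofReal hR
          (Filter.Eventually.of_forall fun x => (hF x).trans (h x))]
    _ ≤ _ := ENNReal.ofReal_le_ofReal hb

/-- Interpolation device: multiplied by `D` of mean at most `β ^ 4`, it bounds the mean of `D * X`
by order `β ^ 2` as soon as `D * X ^ 2` has bounded mean. -/
lemma le_inv_sq_add_sq_mul_sq {β : ℝ} (hβ : 0 < β) (X : ℝ) : X ≤ (β ^ 2)⁻¹ + β ^ 2 * X ^ 2 := by
  have h1 : 0 ≤ (β ^ 2)⁻¹ * (β ^ 2 * X - 1) ^ 2 := by positivity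
  have h2 : (β ^ 2)⁻¹ * (β ^ 2 * X - 1) ^ 2 = β ^ 2 * X ^ 2 - 2 * X + (β ^ 2)⁻¹ := by
    field_simp
    ring
  rcases le_total 0 X with h | h
  · linarith
  · have : 0 ≤ (β ^ 2)⁻¹ + β ^ 2 * X ^ 2 := by positivity
    linarith

lemma exp_three_mul_add_le (a b : ℝ) :
    Real.exp (3 * (a + b)) ≤ (Real.exp (6 * a) + Real.exp (6 * b)) / 2 := by
  have h1 : Real.exp (6 * a) = Real.exp (3 * a) ^ 2 := by rw [← Real.exp_nat_mul]; ring_nf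
  have h2 : Real.exp (6 * b) = Real.exp (3 * b) ^ 2 := by rw [← Real.exp_nat_mul]; ring_nf
  have h3 : Real.exp (3 * (a + b)) = Real.exp (3 * a) * Real.exp (3 * b) := by
    rw [← Real.exp_add]; ring_nf
  rw [h1, h2, h3]
  nlinarith [sq_nonneg (Real.exp (3 * a) - Real.exp (3 * b))]

/-- With `V = a + b`, the weight is at most `2 exp V` and `D ≤ exp V`, so `D * X ^ 2 ≤ 4 exp (3 V)`.
Decoupling `a` from `b` doubles the exponent, which is the origin of the 6. -/
lemma mul_sq_weight_le {a b D β : ℝ} (hβ : 0 < β) (ha : 0 ≤ a) (hb : 0 ≤ b) (hD : 0 ≤ D)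
    (hDV : D ≤ a + b) :
    D * (1 + a ^ 2 + b ^ 2)
      ≤ (β ^ 2)⁻¹ * D + 2 * β ^ 2 * (Real.exp (6 * a) + Real.exp (6 * b)) := by
  set V := a + b with hV
  have hV0 : 0 ≤ V := by positivity
  set X := 1 + a ^ 2 + b ^ 2 with hX
  have h1 := le_inv_sq_add_sq_mul_sq hβ X
  have hX0 : 0 ≤ X := by positivity
  have h2 : X ≤ 2 * Real.exp V := by
    have := Real.quadratic_le_exp_of_nonneg hV0
    have : X ≤ 1 + V ^ 2 := by rw [hX, hV]; nlinarith [mul_nonneg ha hb]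
    linarith
  have h3 : D ≤ Real.exp V := by linarith [Real.add_one_le_exp V]
  have h4 : D * X ^ 2 ≤ Real.exp V * (2 * Real.exp V) ^ 2 := by gcongr
  have h5 : Real.exp V * (2 * Real.exp V) ^ 2 = 4 * Real.exp (3 * V) := by
    have : Real.exp (3 * V) = Real.exp V ^ 3 := by rw [← Real.exp_nat_mul]; norm_num
    rw [this]; ring
  have h6 := exp_three_mul_add_le a b
  have h7 : D * X ≤ D * ((β ^ 2)⁻¹ + β ^ 2 * X ^ 2) := by gcongr
  have h8 : D * X ^ 2 ≤ 2 * (Real.exp (6 * a) + Real.exp (6 * b)) := by linarith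
  have h9 : β ^ 2 * (D * X ^ 2) ≤ β ^ 2 * (2 * (Real.exp (6 * a) + Real.exp (6 * b))) := by gcongr
  linarith

/-- The same interpolation with `X = D * exp D`, using `D ^ 3 ≤ 6 exp D`. -/
lemma sq_mul_exp_le {a b D β : ℝ} (hβ : 0 < β) (hD : 0 ≤ D) (hDV : D ≤ a + b) :
    D ^ 2 * Real.exp D
      ≤ (β ^ 2)⁻¹ * D + 3 * β ^ 2 * (Real.exp (6 * a) + Real.exp (6 * b)) := by
  have h1 := le_inv_sq_add_sq_mul_sq hβ (D * Real.exp D)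
  have h2 : D ^ 3 ≤ 6 * Real.exp D := by
    have := Real.pow_div_factorial_le_exp D hD 3
    norm_num [Nat.factorial] at this
    linarith
  have h3 : D * (D * Real.exp D) ^ 2 ≤ 6 * Real.exp (3 * D) := by
    have : Real.exp (3 * D) = Real.exp D * Real.exp D ^ 2 := by
      rw [← Real.exp_nat_mul, ← Real.exp_add]; push_cast; ring_nf
    rw [this]
    calc D * (D * Real.exp D) ^ 2 = D ^ 3 * Real.exp D ^ 2 := by ring
      _ ≤ 6 * Real.exp D * Real.exp D ^ 2 := by gcongr
      _ = _ := by ring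
  have h4 : Real.exp (3 * D) ≤ Real.exp (3 * (a + b)) := by gcongr
  have h5 := exp_three_mul_add_le a b
  have h6 : D * (D * Real.exp D) ≤ D * ((β ^ 2)⁻¹ + β ^ 2 * (D * Real.exp D) ^ 2) := by gcongr
  have h7 : β ^ 2 * (D * (D * Real.exp D) ^ 2)
      ≤ β ^ 2 * (3 * (Real.exp (6 * a) + Real.exp (6 * b))) := by
    refine mul_le_mul_of_nonneg_left ?_ (by positivity)
    linarith
  linarith

/-- The constant in the exponential moment bound for the deviation of a slice difference. -/
def pairConst (M : ℝ) : ℝ :=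
  1 + 4 * M + Real.pi + 2 * Real.exp M * ((1 + 6 * M) + M * (1 + M ^ 3))

/-- Exponential moment of the deviation of a slice difference whose mean size is `β ^ 4`. -/
theorem lintegral_exp_devNorm_sliceDiff_le [IsProbabilityMeasure P]
    {T T' : 𝒵 → EuclideanSpace ℝ (Fin p)}
    (hT : Measurable T) (hT' : Measurable T') {M β : ℝ} {m : ℕ} (hmpos : 0 < m) (hβ : 0 < β)
    (hβm : β⁻¹ ≤ √m)
    (hTi : Integrable (fun x => Real.exp (6 * ‖T x‖)) P)
    (hTi' : Integrable (fun x => Real.exp (6 * ‖T' x‖)) P)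
    (hTM : ∫ x, Real.exp (6 * ‖T x‖) ∂P ≤ M) (hTM' : ∫ x, Real.exp (6 * ‖T' x‖) ∂P ≤ M)
    (hD : ∫ x, ‖T x - T' x‖ ∂P ≤ β ^ 4) :
    ∫⁻ z : Fin m → 𝒵, ENNReal.ofReal (Real.exp
        (β⁻¹ * (√m * (devNorm P (sliceMeasure p) (sliceDiff T T') z).toReal)))
        ∂(Measure.pi fun _ => P)
      ≤ ENNReal.ofReal (Real.exp (pairConst M)) := by
  set D : 𝒵 → ℝ := fun x => ‖T x - T' x‖ with hDdef
  set eT : 𝒵 → ℝ := fun x => Real.exp (6 * ‖T x‖) + Real.exp (6 * ‖T' x‖) with heT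
  have heTi : Integrable eT P := hTi.add hTi'
  have heTM : ∫ x, eT x ∂P ≤ 2 * M := by
    rw [heT, integral_add hTi hTi']; linarith
  have hM0 : 0 ≤ M := (integral_nonneg fun x => (Real.exp_pos _).le).trans hTM
  have hD0 : ∀ x, 0 ≤ D x := fun x => norm_nonneg _
  have hDV : ∀ x, D x ≤ ‖T x‖ + ‖T' x‖ := fun x => norm_sub_le _ _
  have hDm : Measurable D := (hT.sub hT').norm
  have hexpD : ∀ x, Real.exp (D x) ≤ eT x / 2 := fun x =>
    (Real.exp_le_exp.2 (by linarith [hDV x, hD0 x])).trans (exp_three_mul_add_le _ _)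
  have hDe : ∀ x, D x ≤ eT x / 2 := fun x =>
    le_trans (by linarith [Real.add_one_le_exp (D x)]) (hexpD x)
  have hDi : Integrable D P := Integrable.mono' (heTi.div_const 2) hDm.aestronglyMeasurable
    (Filter.Eventually.of_forall fun x => by
      rw [Real.norm_of_nonneg (hD0 x)]; exact hDe x)
  set c := ∫ x, D x ∂P with hc
  have hc0 : 0 ≤ c := integral_nonneg hD0
  have hcM : c ≤ M := by
    have := integral_mono hDi (heTi.div_const 2) hDe
    rw [integral_div] at this
    linarith
  have hβ2 : (β ^ 2)⁻¹ * β ^ 4 = β ^ 2 := by field_simp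
  have hβc : (β ^ 2)⁻¹ * c ≤ β ^ 2 := by
    exact (mul_le_mul_of_nonneg_left hD (by positivity)).trans_eq hβ2
  have hmean : ∫⁻ z : Fin m → 𝒵, devNorm P (sliceMeasure p) (sliceDiff T T') z
      ∂(Measure.pi fun _ => P) ≤ ENNReal.ofReal ((√m)⁻¹ * (β * (1 + 4 * M + Real.pi))) := by
    have hA : ∫⁻ x, ∫⁻ e, ENNReal.ofReal (|sliceDiff T T' x e| * (1 + e.2 ^ 2))
        ∂(sliceMeasure p) ∂P ≤ ENNReal.ofReal (β ^ 2 * (1 + 4 * M)) := by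
      refine (lintegral_mono fun x => lintegral_abs_sliceDiff_mul_le hT hT' x).trans ?_
      refine lintegral_ofReal_le_of_le (R := fun x => (β ^ 2)⁻¹ * D x + 2 * β ^ 2 * eT x)
        (fun x => by positivity)
        (fun x => mul_sq_weight_le hβ (norm_nonneg _) (norm_nonneg _) (hD0 x) (hDV x))
        ((hDi.const_mul _).add (heTi.const_mul _)) ?_
      rw [integral_add (hDi.const_mul _) (heTi.const_mul _), integral_const_mul,
        integral_const_mul]
      have : 2 * β ^ 2 * ∫ x, eT x ∂P ≤ 2 * β ^ 2 * (2 * M) := by gcongr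
      linarith
    -- The choice `a = β⁻¹` balances a first term of order `β⁻¹ β²` against `β π`.
    refine (lintegral_devNorm_le hmpos (measurable_sliceDiff hT hT')
      (abs_sliceDiff_le_one T T') (w := fun e => 1 + e.2 ^ 2) (by fun_prop)
      (fun e => by positivity) (inv_pos.2 hβ) (by positivity) Real.pi_pos.le hA
      (lintegral_inv_one_add_sq_le p)).trans (le_of_eq ?_)
    congr 2
    field_simp
  set W := β ^ 2 * (2 * Real.exp M * ((1 + 6 * M) + M * (1 + M ^ 3))) with hW
  -- Interpolation again, for the number `c`: `c ≤ β ^ 4` bounds one term and `c ≤ M` the other. No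
  -- upper bound on `β` is needed.
  have hc2 : c ^ 2 ≤ β ^ 2 * (1 + M ^ 3) := by
    have h1 := le_inv_sq_add_sq_mul_sq hβ c
    have h2 : c * c ≤ c * ((β ^ 2)⁻¹ + β ^ 2 * c ^ 2) := by gcongr
    have h3 : c ^ 3 ≤ M ^ 3 := by gcongr
    have h4 : β ^ 2 * c ^ 3 ≤ β ^ 2 * M ^ 3 := by gcongr
    calc c ^ 2 = c * c := by ring
      _ ≤ (β ^ 2)⁻¹ * c + β ^ 2 * c ^ 3 := by linarith
      _ ≤ β ^ 2 + β ^ 2 * M ^ 3 := by linarith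
      _ = _ := by ring
  have hWle : ∫⁻ x, ENNReal.ofReal ((D x + c) ^ 2 * Real.exp (D x + c)) ∂P
      ≤ ENNReal.ofReal W := by
    refine lintegral_ofReal_le_of_le (R := fun x => 2 * Real.exp M * ((β ^ 2)⁻¹ * D x
      + (3 * β ^ 2 + β ^ 2 * (1 + M ^ 3) / 2) * eT x)) (fun x => by positivity) (fun x => ?_)
      (((hDi.const_mul _).add (heTi.const_mul _)).const_mul _) ?_
    · have h1 := sq_mul_exp_le hβ (hD0 x) (hDV x)
      have h2 : c ^ 2 * Real.exp (D x) ≤ β ^ 2 * (1 + M ^ 3) * (eT x / 2) := by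
        gcongr
        exact hexpD x
      have h3 : (D x + c) ^ 2 ≤ 2 * (D x ^ 2 + c ^ 2) := by nlinarith [sq_nonneg (D x - c)]
      calc (D x + c) ^ 2 * Real.exp (D x + c)
          ≤ 2 * (D x ^ 2 + c ^ 2) * (Real.exp (D x) * Real.exp M) := by
            rw [Real.exp_add]
            gcongr
        _ = 2 * Real.exp M * (D x ^ 2 * Real.exp (D x) + c ^ 2 * Real.exp (D x)) := by ring
        _ ≤ _ := by
            refine mul_le_mul_of_nonneg_left ?_ (by positivity)
            simp only [heT] at h2 ⊢
            linarith
    · rw [integral_const_mul, integral_add (hDi.const_mul _) (heTi.const_mul _),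
        integral_const_mul, integral_const_mul, hW]
      have h1 : (3 * β ^ 2 + β ^ 2 * (1 + M ^ 3) / 2) * ∫ x, eT x ∂P
          ≤ (3 * β ^ 2 + β ^ 2 * (1 + M ^ 3) / 2) * (2 * M) := by gcongr
      calc _ ≤ 2 * Real.exp M * (β ^ 2 + (3 * β ^ 2 + β ^ 2 * (1 + M ^ 3) / 2) * (2 * M)) := by
            gcongr
        _ = _ := by ring
  -- With `s = β⁻¹` the mean is of order `β` and `W` of order `β ^ 2`, so all powers of `β` cancel
  -- and leave `pairConst M`.
  refine (lintegral_exp_devNorm_le hmpos (measurable_sliceDiff hT hT') (abs_sliceDiff_le_one T T')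
    hD0 hDm hDi (lintegral_abs_sliceDiff_le hT hT') (inv_pos.2 hβ).le hβm
    (A := β * (1 + 4 * M + Real.pi)) (W := W) (by positivity) (by positivity) hmean hWle).trans
    (le_of_eq ?_)
  congr 2
  rw [hW, pairConst]
  field_simp

end Pair

/-! ### From sub-Gaussian norms to exponential moments. -/

section SubGaussian

/-- The norm is at most `p` times the largest coordinate, whose exponential is one term of the sum.
The summand 1 covers `p = 0`. -/
lemma exp_norm_le_one_add_sum {p : ℕ} (x : EuclideanSpace ℝ (Fin p)) :
    Real.exp (6 * ‖x‖) ≤ 1 + ∑ i, Real.exp (6 * p * |x i|) := by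
  rcases Nat.eq_zero_or_pos p with rfl | hp
  · have : x = 0 := Subsingleton.elim _ _
    simp [this]
  · have : Nonempty (Fin p) := ⟨⟨0, hp⟩⟩
    obtain ⟨i, hi⟩ := Finite.exists_max fun i => |x i|
    have hp1 : (1 : ℝ) ≤ p := by exact_mod_cast hp
    have h1 : ‖x‖ ≤ p * |x i| := by
      refine le_of_sq_le_sq ?_ (by positivity)
      rw [EuclideanSpace.real_norm_sq_eq]
      calc ∑ j, x j ^ 2 ≤ ∑ _j : Fin p, |x i| ^ 2 := by
            refine Finset.sum_le_sum fun j _ => ?_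
            rw [← sq_abs]
            exact pow_le_pow_left₀ (abs_nonneg _) (hi j) 2
        _ = p * |x i| ^ 2 := by simp
        _ ≤ p ^ 2 * |x i| ^ 2 := by gcongr; nlinarith
        _ = _ := by ring
    have h2 : Real.exp (6 * p * |x i|) ≤ ∑ i, Real.exp (6 * p * |x i|) :=
      Finset.single_le_sum (f := fun i => Real.exp (6 * p * |x i|))
        (fun _ _ => (Real.exp_pos _).le) (Finset.mem_univ i)
    have h3 : Real.exp (6 * ‖x‖) ≤ Real.exp (6 * p * |x i|) := by
      refine Real.exp_le_exp.2 ?_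
      linarith
    linarith

/-- A bound for the exponential moment of a sub-Gaussian vector. -/
def momentConst (p : ℕ) (K : ℝ) : ℝ :=
  1 + p * (Real.exp (9 * p ^ 2 * (K + 1) ^ 2) * 2)

/-- The infimum need not be attained and `K` may be zero; `K + 1` lies strictly above some
admissible constant, and the integrand decreases in the constant. -/
lemma lintegral_exp_sq_le_of_psi2Norm_le {ν : Measure ℝ} {K : ℝ≥0} (h : psi2Norm ν ≤ K) :
    ∫⁻ y, ENNReal.ofReal (Real.exp (y ^ 2 / ((K : ℝ) + 1) ^ 2)) ∂ν ≤ 2 := by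
  have hlt : psi2Norm ν < ((K + 1 : ℝ≥0) : ℝ≥0∞) :=
    h.trans_lt (by exact_mod_cast lt_add_one K)
  unfold psi2Norm at hlt
  simp only [iInf_lt_iff] at hlt
  obtain ⟨K₀, ⟨hK₀, hint⟩, hK⟩ := hlt
  have hK' : (K₀ : ℝ) ≤ K + 1 := by
    have : K₀ < K + 1 := by exact_mod_cast hK
    exact_mod_cast this.le
  have hK₀' : (0 : ℝ) < K₀ := by exact_mod_cast hK₀
  refine (lintegral_mono fun y => ENNReal.ofReal_le_ofReal (Real.exp_le_exp.2 ?_)).trans hint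
  gcongr

variable {𝒵 : Type*} [MeasurableSpace 𝒵] {P : Measure 𝒵} [IsProbabilityMeasure P] {p : ℕ}

lemma lintegral_exp_norm_le_of_psi2NormVec_le {T : 𝒵 → EuclideanSpace ℝ (Fin p)}
    (hT : Measurable T) {K : ℝ≥0} (h : psi2NormVec (P.map T) ≤ K) :
    ∫⁻ x, ENNReal.ofReal (Real.exp (6 * ‖T x‖)) ∂P ≤ ENNReal.ofReal (momentConst p K) := by
  have hcoord : ∀ i : Fin p, ∫⁻ x, ENNReal.ofReal (Real.exp (6 * p * |T x i|)) ∂P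
      ≤ ENNReal.ofReal (Real.exp (9 * p ^ 2 * ((K : ℝ) + 1) ^ 2) * 2) := by
    intro i
    have hω : EuclideanSpace.single i (1 : ℝ) ∈ Metric.sphere (0 : EuclideanSpace ℝ (Fin p)) 1 := by
      simp
    have h1 : psi2Norm (proj (P.map T) (EuclideanSpace.single i 1)) ≤ K :=
      (le_iSup (fun ω : Metric.sphere (0 : EuclideanSpace ℝ (Fin p)) 1 =>
        psi2Norm (proj (P.map T) ω)) ⟨_, hω⟩).trans h
    have h2 := lintegral_exp_sq_le_of_psi2Norm_le h1
    unfold proj at h2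
    have hin : Measurable fun x : EuclideanSpace ℝ (Fin p) =>
        inner ℝ (EuclideanSpace.single i (1 : ℝ)) x := by fun_prop
    rw [lintegral_map (by fun_prop) hin, lintegral_map (by fun_prop) hT] at h2
    simp only [EuclideanSpace.inner_single_left, map_one, one_mul] at h2
    calc ∫⁻ x, ENNReal.ofReal (Real.exp (6 * p * |T x i|)) ∂P
        ≤ ∫⁻ x, ENNReal.ofReal (Real.exp (9 * p ^ 2 * ((K : ℝ) + 1) ^ 2))
          * ENNReal.ofReal (Real.exp (T x i ^ 2 / ((K : ℝ) + 1) ^ 2)) ∂P := by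
          refine lintegral_mono fun x => ?_
          rw [← ENNReal.ofReal_mul (Real.exp_pos _).le, ← Real.exp_add]
          refine ENNReal.ofReal_le_ofReal (Real.exp_le_exp.2 ?_)
          have hK : (0 : ℝ) < K + 1 := by positivity
          -- Completing the square bounds the linear exponent by the quadratic one plus a constant.
          have h3 := sq_nonneg (|T x i| / ((K : ℝ) + 1) - 3 * p * ((K : ℝ) + 1))
          have h4 : (|T x i| / ((K : ℝ) + 1) - 3 * p * ((K : ℝ) + 1)) ^ 2
              = T x i ^ 2 / ((K : ℝ) + 1) ^ 2 - 6 * p * |T x i|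
                + 9 * p ^ 2 * ((K : ℝ) + 1) ^ 2 := by
            rw [← sq_abs (T x i)]
            field_simp
            ring
          linarith
      _ = ENNReal.ofReal (Real.exp (9 * p ^ 2 * ((K : ℝ) + 1) ^ 2))
          * ∫⁻ x, ENNReal.ofReal (Real.exp (T x i ^ 2 / ((K : ℝ) + 1) ^ 2)) ∂P :=
          lintegral_const_mul' _ _ ENNReal.ofReal_ne_top
      _ ≤ ENNReal.ofReal (Real.exp (9 * p ^ 2 * ((K : ℝ) + 1) ^ 2)) * 2 := by gcongr
      _ = _ := by
          rw [ENNReal.ofReal_mul (Real.exp_pos _).le]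
          norm_num
  calc ∫⁻ x, ENNReal.ofReal (Real.exp (6 * ‖T x‖)) ∂P
      ≤ ∫⁻ x, (1 + ∑ i, ENNReal.ofReal (Real.exp (6 * p * |T x i|))) ∂P := by
        refine lintegral_mono fun x => ?_
        rw [← ENNReal.ofReal_sum_of_nonneg (fun i _ => (Real.exp_pos _).le),
          ← ENNReal.ofReal_one, ← ENNReal.ofReal_add zero_le_one
            (Finset.sum_nonneg fun i _ => (Real.exp_pos _).le)]
        exact ENNReal.ofReal_le_ofReal (exp_norm_le_one_add_sum _)
    _ = 1 + ∑ i, ∫⁻ x, ENNReal.ofReal (Real.exp (6 * p * |T x i|)) ∂P := by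
        rw [lintegral_add_left measurable_const, lintegral_finsetSum _ fun i _ => by fun_prop]
        simp
    _ ≤ 1 + ∑ _i : Fin p, ENNReal.ofReal (Real.exp (9 * p ^ 2 * ((K : ℝ) + 1) ^ 2) * 2) := by
        gcongr with i
        exact hcoord i
    _ = _ := by
        rw [← ENNReal.ofReal_sum_of_nonneg (fun i _ => by positivity), ← ENNReal.ofReal_one,
          ← ENNReal.ofReal_add zero_le_one (Finset.sum_nonneg fun i _ => by positivity)]
        simp [momentConst]

lemma integrable_exp_norm_of_psi2NormVec_le {T : 𝒵 → EuclideanSpace ℝ (Fin p)}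
    (hT : Measurable T) {K : ℝ≥0} (h : psi2NormVec (P.map T) ≤ K) :
    Integrable (fun x => Real.exp (6 * ‖T x‖)) P := by
  refine ⟨(by fun_prop : Measurable fun x => Real.exp (6 * ‖T x‖)).aestronglyMeasurable, ?_⟩
  rw [hasFiniteIntegral_iff_ofReal (Filter.Eventually.of_forall fun x => (Real.exp_pos _).le)]
  exact (lintegral_exp_norm_le_of_psi2NormVec_le hT h).trans_lt ENNReal.ofReal_lt_top

lemma integral_exp_norm_le_of_psi2NormVec_le {T : 𝒵 → EuclideanSpace ℝ (Fin p)}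
    (hT : Measurable T) {K : ℝ≥0} (h : psi2NormVec (P.map T) ≤ K) :
    ∫ x, Real.exp (6 * ‖T x‖) ∂P ≤ momentConst p K := by
  rw [integral_eq_lintegral_of_nonneg_ae (Filter.Eventually.of_forall fun x => (Real.exp_pos _).le)
    (by fun_prop : Measurable fun x => Real.exp (6 * ‖T x‖)).aestronglyMeasurable]
  refine ENNReal.toReal_le_of_le_ofReal ?_ (lintegral_exp_norm_le_of_psi2NormVec_le hT h)
  unfold momentConst
  positivity

end SubGaussian

/-! ### Finite nets in a bounded set. -/

section Nets

/-- Bounded sets in `ℝ^d` have nets of mesh `16⁻ᵏ` whose log-cardinality is linear in `k`. -/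
theorem exists_net {d : ℕ} {Θ : Set (EuclideanSpace ℝ (Fin d))} (hΘ : Bornology.IsBounded Θ) :
    ∃ c : ℝ, 0 ≤ c ∧ ∀ k : ℕ, ∃ N : Finset (EuclideanSpace ℝ (Fin d)), ↑N ⊆ Θ ∧
      Real.log N.card ≤ c * (k + 1) ∧ ∀ θ ∈ Θ, ∃ θ' ∈ N, ‖θ - θ'‖ ≤ d * (16 ^ k)⁻¹ := by
  obtain ⟨R, hR⟩ := hΘ.exists_norm_le
  obtain ⟨B, hB⟩ := exists_nat_ge R
  have hcoord : ∀ θ ∈ Θ, ∀ i, |θ i| ≤ B := fun θ hθ i => by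
    have := PiLp.norm_apply_le θ i
    rw [Real.norm_eq_abs] at this
    linarith [hR θ hθ]
  have hlog16 : 0 ≤ Real.log 16 := Real.log_nonneg (by norm_num)
  have hlogB : 0 ≤ Real.log (2 * B + 1) := Real.log_nonneg (by linarith [B.cast_nonneg (α := ℝ)])
  refine ⟨d * (Real.log (2 * B + 1) + Real.log 16), by positivity, fun k => ?_⟩
  set φ : EuclideanSpace ℝ (Fin d) → (Fin d → ℤ) := fun θ i => ⌊(16 : ℝ) ^ k * θ i⌋ with hφ
  set C : Finset (Fin d → ℤ) :=
    Fintype.piFinset fun _ => Finset.Icc (-(B * 16 ^ k : ℕ) : ℤ) (B * 16 ^ k : ℕ) with hC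
  have hmaps : ∀ θ ∈ Θ, φ θ ∈ C := by
    intro θ hθ
    rw [hC, Fintype.mem_piFinset]
    intro i
    have h1 := abs_le.1 (hcoord θ hθ i)
    have h16 : (0 : ℝ) < 16 ^ k := by positivity
    rw [Finset.mem_Icc]
    constructor
    · refine Int.le_floor.2 ?_
      push_cast
      nlinarith
    · have : (⌊(16 : ℝ) ^ k * θ i⌋ : ℝ) ≤ ((B * 16 ^ k : ℕ) : ℤ) := by
        refine (Int.floor_le _).trans ?_
        push_cast
        nlinarith
      exact Int.cast_le.1 this
  -- One point of `Θ` per occupied grid cell of side `16⁻ᵏ`, so that the net stays inside `Θ`.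
  obtain ⟨S, hSΘ, hS⟩ := (Set.surjOn_image φ Θ).exists_bijOn_subset
  have hSC : Set.MapsTo φ S C := fun θ hθ => hmaps θ (hSΘ hθ)
  have hfin : S.Finite := Set.Finite.of_finite_image
    (C.finite_toSet.subset (Set.image_subset_iff.2 hSC)) hS.injOn
  refine ⟨hfin.toFinset, by simpa using hSΘ, ?_, ?_⟩
  · have hcard : hfin.toFinset.card ≤ C.card :=
      Finset.card_le_card_of_injOn φ (by simpa using hSC) (by simpa using hS.injOn)
    have hCcard : C.card = (2 * (B * 16 ^ k) + 1) ^ d := by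
      rw [hC, Fintype.card_piFinset]
      simp only [Int.card_Icc, Finset.prod_const, Finset.card_univ, Fintype.card_fin]
      congr 1
      omega
    -- An empty net is harmless because `Real.log 0 = 0`.
    rcases Nat.eq_zero_or_pos hfin.toFinset.card with h0 | hpos
    · rw [h0, Nat.cast_zero, Real.log_zero]
      positivity
    · have h2 : (hfin.toFinset.card : ℝ) ≤ ((2 * B + 1) * 16 ^ k) ^ d := by
        calc (hfin.toFinset.card : ℝ) ≤ C.card := by exact_mod_cast hcard
          _ = (2 * (B * 16 ^ k) + 1) ^ d := by rw [hCcard]; push_cast; rfl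
          _ ≤ _ := by
            gcongr
            have : (1 : ℝ) ≤ 16 ^ k := one_le_pow₀ (by norm_num)
            linarith
      refine (Real.log_le_log (by exact_mod_cast hpos) h2).trans ?_
      rw [Real.log_pow, Real.log_mul (by positivity) (by positivity), Real.log_pow]
      have hk : (0 : ℝ) ≤ k := k.cast_nonneg
      rw [mul_assoc]
      gcongr
      nlinarith
  · intro θ hθ
    obtain ⟨θ', hθ', heq⟩ := hS.surjOn (Set.mem_image_of_mem φ hθ)
    refine ⟨θ', by simpa using hθ', ?_⟩
    have h16 : (0 : ℝ) < 16 ^ k := by positivity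
    have hi : ∀ i, |(θ - θ') i| ≤ (16 ^ k)⁻¹ := by
      intro i
      have h1 : ⌊(16 : ℝ) ^ k * θ' i⌋ = ⌊(16 : ℝ) ^ k * θ i⌋ := congrFun heq i
      have h2 := Int.abs_sub_lt_one_of_floor_eq_floor h1.symm
      rw [← mul_sub, abs_mul, abs_of_pos h16] at h2
      rw [← one_div, le_div_iff₀ h16, mul_comm]
      exact h2.le
    refine le_of_sq_le_sq ?_ (by positivity)
    rw [EuclideanSpace.real_norm_sq_eq]
    calc ∑ i, (θ - θ') i ^ 2 ≤ ∑ _i : Fin d, ((16 : ℝ) ^ k)⁻¹ ^ 2 := by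
          refine Finset.sum_le_sum fun i _ => ?_
          rw [← sq_abs]
          exact pow_le_pow_left₀ (abs_nonneg _) (hi i) 2
      _ = d * ((16 : ℝ) ^ k)⁻¹ ^ 2 := by simp
      _ ≤ d ^ 2 * ((16 : ℝ) ^ k)⁻¹ ^ 2 := by
          gcongr
          exact_mod_cast Nat.le_self_pow two_ne_zero d
      _ = _ := by ring

end Nets

/-! ### The sliced distance as an L¹ deviation. -/

section SlicedBound

variable {𝒵 : Type*} [MeasurableSpace 𝒵] {P : Measure 𝒵} [IsProbabilityMeasure P] {p m : ℕ}

lemma empirical_proj_real_Iic (hmpos : 0 < m) (x : Fin m → EuclideanSpace ℝ (Fin p))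
    (ω : EuclideanSpace ℝ (Fin p)) (t : ℝ) :
    IsProbabilityMeasure (proj (empirical x) ω) ∧
      (proj (empirical x) ω).real (Set.Iic t) = (m : ℝ)⁻¹ * ∑ j, step (inner ℝ ω (x j)) t := by
  have hin : Measurable fun y : EuclideanSpace ℝ (Fin p) => inner ℝ ω y := by fun_prop
  constructor
  · refine ⟨?_⟩
    rw [proj, Measure.map_apply hin MeasurableSet.univ]
    simp only [empirical, Set.preimage_univ, Measure.smul_apply, Measure.finsetSum_apply,
      measure_univ, smul_eq_mul, Finset.sum_const, Finset.card_univ, Fintype.card_fin,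
      nsmul_eq_mul, mul_one]
    exact ENNReal.inv_mul_cancel (by exact_mod_cast hmpos.ne') (ENNReal.natCast_ne_top m)
  · rw [measureReal_def, proj, Measure.map_apply hin measurableSet_Iic]
    simp only [empirical, Measure.smul_apply, Measure.finsetSum_apply, smul_eq_mul]
    rw [ENNReal.toReal_mul, ENNReal.toReal_inv, ENNReal.toReal_natCast,
      ENNReal.toReal_sum fun j _ => measure_ne_top _ _]
    congr 1
    refine Finset.sum_congr rfl fun j _ => ?_
    rw [Measure.dirac_apply' _ (hin measurableSet_Iic)]
    by_cases h : inner ℝ ω (x j) ≤ t <;> simp [step, h]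

lemma proj_map_real_Iic {T : 𝒵 → EuclideanSpace ℝ (Fin p)} (hT : Measurable T)
    (ω : EuclideanSpace ℝ (Fin p)) (t : ℝ) :
    IsProbabilityMeasure (proj (P.map T) ω) ∧
      (proj (P.map T) ω).real (Set.Iic t) = ∫ x, step (inner ℝ ω (T x)) t ∂P := by
  have hin : Measurable fun y : EuclideanSpace ℝ (Fin p) => inner ℝ ω y := by fun_prop
  have hmap : proj (P.map T) ω = P.map fun x => inner ℝ ω (T x) := Measure.map_map hin hT
  have hc : Measurable fun x => inner ℝ ω (T x) := hin.comp hT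
  rw [hmap]
  refine ⟨Measure.isProbabilityMeasure_map hc.aemeasurable, ?_⟩
  rw [map_measureReal_apply hc measurableSet_Iic, ← integral_indicator_one
    (hc measurableSet_Iic)]
  refine integral_congr_ae (Filter.Eventually.of_forall fun x => ?_)
  by_cases h : inner ℝ ω (T x) ≤ t <;> simp [step, h]

/-- The sliced distance of the empirical law to the law is at most the `L¹` deviation of slices. -/
theorem slicedW_le_devNorm (hmpos : 0 < m) {T : 𝒵 → EuclideanSpace ℝ (Fin p)}
    (hT : Measurable T) (z : Fin m → 𝒵) :
    slicedW (empirical fun j => T (z j)) (P.map T)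
      ≤ devNorm P (sliceMeasure p) (sliceDiff T fun _ => 0) z := by
  have hm := measurable_sliceDiff hT (measurable_const (a := (0 : EuclideanSpace ℝ (Fin p))))
  have hd : Measurable fun e => ENNReal.ofReal |dev P (sliceDiff T fun _ => 0) z e| :=
    ((measurable_dev hm).comp (measurable_const.prodMk measurable_id)).abs.ennreal_ofReal
  unfold slicedW devNorm
  rw [lintegral_prod _ hd.aemeasurable]
  refine lintegral_mono fun ω => ?_
  have h1 := (empirical_proj_real_Iic hmpos (fun j => T (z j)) ω 0).1
  have h2 := (proj_map_real_Iic (P := P) hT ω 0).1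
  refine (wasserstein1_le_lintegral_cdf _ _).trans (lintegral_mono fun t => le_of_eq ?_)
  rw [ProbabilityTheory.cdf_eq_real, ProbabilityTheory.cdf_eq_real,
    (empirical_proj_real_Iic hmpos (fun j => T (z j)) ω t).2, (proj_map_real_Iic hT ω t).2]
  congr 2
  have hi : Integrable (fun x => slice T x (ω, t)) P := by
    refine Integrable.of_bound
      ((measurable_slice hT).comp (measurable_id.prodMk measurable_const)).aestronglyMeasurable 1
      (Filter.Eventually.of_forall fun x => ?_)
    unfold slice step
    split_ifs <;> simp
  have hm0 : (m : ℝ) ≠ 0 := by positivity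
  -- The slice of the zero map does not depend on the sample and cancels in the deviation. It is
  -- subtracted because a single slice equals 1 for all large `t`, hence is not integrable.
  simp only [dev, sliceDiff]
  rw [integral_sub hi (by simp [slice]), Finset.sum_sub_distrib]
  simp only [slice, Finset.sum_const, Finset.card_univ, Fintype.card_fin, nsmul_eq_mul,
    integral_const, probReal_univ, one_smul]
  field_simp
  ring

lemma devNorm_sliceDiff_triangle {T T' T'' : 𝒵 → EuclideanSpace ℝ (Fin p)} (hT : Measurable T)
    (hT' : Measurable T') (hT'' : Measurable T'') (z : Fin m → 𝒵) :
    devNorm P (sliceMeasure p) (sliceDiff T T'') z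
      ≤ devNorm P (sliceMeasure p) (sliceDiff T T') z
        + devNorm P (sliceMeasure p) (sliceDiff T' T'') z := by
  refine le_trans (le_of_eq ?_) (devNorm_add_le (measurable_sliceDiff hT hT')
    (measurable_sliceDiff hT' hT'') (abs_sliceDiff_le_one _ _) (abs_sliceDiff_le_one _ _) z)
  congr 1
  funext x e
  simp [sliceDiff]

end SlicedBound

/-! ### Maximum of finitely many variables. -/

section Maximal

/-- A maximal inequality for finitely many variables with bounded exponential moments. -/
lemma exists_majorant {Ω ι : Type*} [MeasurableSpace Ω] {μ : Measure Ω} [IsProbabilityMeasure μ]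
    (N : Finset ι) (Y : ι → Ω → ℝ) (hY : ∀ i ∈ N, Measurable (Y i)) {β C : ℝ} (hβ : 0 < β)
    (hC : 0 ≤ C)
    (hexp : ∀ i ∈ N, ∫⁻ x, ENNReal.ofReal (Real.exp (β⁻¹ * Y i x)) ∂μ
      ≤ ENNReal.ofReal (Real.exp C)) :
    ∃ R : Ω → ℝ≥0∞, Measurable R ∧ (∀ i ∈ N, ∀ x, ENNReal.ofReal (Y i x) ≤ R x) ∧
      ∫⁻ x, R x ∂μ ≤ ENNReal.ofReal (β * (Real.log N.card + C + 1)) := by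
  rcases N.eq_empty_or_nonempty with rfl | hne
  · exact ⟨0, measurable_const, by simp, by simp⟩
  have hcard : (0 : ℝ) < N.card := by exact_mod_cast hne.card_pos
  have hlog : 0 ≤ Real.log N.card :=
    Real.log_nonneg (by exact_mod_cast hne.card_pos)
  -- With `u = Y / β`, one has `u ≤ l + exp (u - l)`; summing the exponentials over `N` replaces the
  -- maximum. This `l` makes the bound on the mean of that sum equal to 1.
  set l := Real.log N.card + C with hl
  have hl0 : 0 ≤ l := by positivity
  have hel : Real.exp (-l) * (N.card * Real.exp C) = 1 := by
    rw [hl, neg_add, Real.exp_add, Real.exp_neg, Real.exp_log hcard, Real.exp_neg]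
    field_simp
  have hmeas : ∀ i ∈ N, Measurable fun x => ENNReal.ofReal (Real.exp (β⁻¹ * Y i x)) :=
    fun i hi => (Real.measurable_exp.comp ((hY i hi).const_mul _)).ennreal_ofReal
  have hsum : Measurable fun x => ∑ i ∈ N, ENNReal.ofReal (Real.exp (β⁻¹ * Y i x)) :=
    Finset.measurable_sum _ hmeas
  refine ⟨fun x => ENNReal.ofReal (β * l) + ENNReal.ofReal (β * Real.exp (-l))
    * ∑ i ∈ N, ENNReal.ofReal (Real.exp (β⁻¹ * Y i x)), (hsum.const_mul _).const_add _, ?_, ?_⟩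
  · intro i hi x
    have h1 : ENNReal.ofReal (Real.exp (β⁻¹ * Y i x))
        ≤ ∑ i ∈ N, ENNReal.ofReal (Real.exp (β⁻¹ * Y i x)) :=
      Finset.single_le_sum (f := fun i => ENNReal.ofReal (Real.exp (β⁻¹ * Y i x)))
        (fun _ _ => zero_le) hi
    calc ENNReal.ofReal (Y i x)
        ≤ ENNReal.ofReal (β * l) + ENNReal.ofReal (β * Real.exp (-l))
          * ENNReal.ofReal (Real.exp (β⁻¹ * Y i x)) := by
          rw [← ENNReal.ofReal_mul (by positivity), ← ENNReal.ofReal_add (by positivity)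
            (by positivity)]
          refine ENNReal.ofReal_le_ofReal ?_
          rw [mul_assoc, ← Real.exp_add, ← mul_add]
          have h2 := Real.add_one_le_exp (-l + β⁻¹ * Y i x)
          have h3 : Y i x = β * (β⁻¹ * Y i x) := by field_simp
          calc Y i x = β * (β⁻¹ * Y i x) := h3
            _ ≤ _ := by
              refine mul_le_mul_of_nonneg_left ?_ hβ.le
              linarith
      _ ≤ _ := add_le_add le_rfl (mul_le_mul' le_rfl h1)
  · rw [lintegral_add_left measurable_const, lintegral_const_mul' _ _ ENNReal.ofReal_ne_top,
      lintegral_finsetSum _ hmeas, lintegral_const, measure_univ, mul_one]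
    calc _ ≤ ENNReal.ofReal (β * l) + ENNReal.ofReal (β * Real.exp (-l))
          * ∑ _i ∈ N, ENNReal.ofReal (Real.exp C) := by
          gcongr with i hi
          exact hexp i hi
      _ = _ := by
          rw [← ENNReal.ofReal_sum_of_nonneg fun _ _ => (Real.exp_pos _).le,
            ← ENNReal.ofReal_mul (by positivity), Finset.sum_const, nsmul_eq_mul, mul_assoc, hel,
            ← ENNReal.ofReal_add (by positivity) (by positivity)]
          congr 1
          ring

end Maximal

/-! ### Chaining along the nets. -/

section Chaining

variable {𝒵 : Type*} [MeasurableSpace 𝒵] {P : Measure 𝒵} [IsProbabilityMeasure P] {p m : ℕ}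

lemma pairConst_nonneg {M : ℝ} (hM : 0 ≤ M) : 0 ≤ pairConst M := by
  unfold pairConst
  positivity

/-- One link of the chain: simultaneous control of finitely many slice deviations. -/
lemma exists_majorant_sliceDiff {ι : Type*} (N : Finset ι)
    (T T' : ι → 𝒵 → EuclideanSpace ℝ (Fin p)) (hT : ∀ i ∈ N, Measurable (T i))
    (hT' : ∀ i ∈ N, Measurable (T' i)) {M β : ℝ} (hmpos : 0 < m) (hM : 0 ≤ M) (hβ : 0 < β)
    (hβm : β⁻¹ ≤ √m)
    (hTi : ∀ i ∈ N, Integrable (fun x => Real.exp (6 * ‖T i x‖)) P)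
    (hTi' : ∀ i ∈ N, Integrable (fun x => Real.exp (6 * ‖T' i x‖)) P)
    (hTM : ∀ i ∈ N, ∫ x, Real.exp (6 * ‖T i x‖) ∂P ≤ M)
    (hTM' : ∀ i ∈ N, ∫ x, Real.exp (6 * ‖T' i x‖) ∂P ≤ M)
    (hD : ∀ i ∈ N, ∫ x, ‖T i x - T' i x‖ ∂P ≤ β ^ 4) :
    ∃ R : (Fin m → 𝒵) → ℝ≥0∞, Measurable R ∧
      (∀ i ∈ N, ∀ z, ENNReal.ofReal √m
        * devNorm P (sliceMeasure p) (sliceDiff (T i) (T' i)) z ≤ R z) ∧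
      ∫⁻ z, R z ∂(Measure.pi fun _ => P)
        ≤ ENNReal.ofReal (β * (Real.log N.card + pairConst M + 1)) := by
  obtain ⟨R, hRm, hR, hRi⟩ := exists_majorant (μ := Measure.pi fun _ : Fin m => P) N
    (fun i z => √m * (devNorm P (sliceMeasure p) (sliceDiff (T i) (T' i)) z).toReal)
    (fun i hi => ((measurable_devNorm (measurable_sliceDiff (hT i hi)
      (hT' i hi))).ennreal_toReal).const_mul _) hβ (pairConst_nonneg hM)
    (fun i hi => lintegral_exp_devNorm_sliceDiff_le (hT i hi) (hT' i hi) hmpos hβ hβm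
      (hTi i hi) (hTi' i hi) (hTM i hi) (hTM' i hi) (hD i hi))
  refine ⟨R, hRm, fun i hi z => ?_, hRi⟩
  refine le_trans ?_ (hR i hi z)
  rw [ENNReal.ofReal_mul (Real.sqrt_nonneg _)]
  gcongr
  -- The real-valued bound transfers only if the norm is finite, since `toReal` sends infinity to 0.
  refine (ENNReal.ofReal_toReal ?_).ge
  have hDi : Integrable (fun x => ‖T i x - T' i x‖) P := by
    refine Integrable.mono' ((hTi i hi).add (hTi' i hi))
      ((hT i hi).sub (hT' i hi)).norm.aestronglyMeasurable
      (Filter.Eventually.of_forall fun x => ?_)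
    rw [norm_norm]
    have h1 := norm_sub_le (T i x) (T' i x)
    have h2 := Real.add_one_le_exp (6 * ‖T i x‖)
    have h3 := Real.add_one_le_exp (6 * ‖T' i x‖)
    simp only [Pi.add_apply]
    linarith [norm_nonneg (T i x), norm_nonneg (T' i x)]
  exact ((devNorm_le (measurable_sliceDiff (hT i hi) (hT' i hi)) (abs_sliceDiff_le_one _ _)
    (fun _ => norm_nonneg _) hDi (lintegral_abs_sliceDiff_le (hT i hi) (hT' i hi))
    z).trans_lt ENNReal.ofReal_lt_top).ne

/-- Chaining along nets of mesh proportional to `16⁻ᵏ`. -/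
theorem exists_majorant_chain {ι : Type*} {Θ : Set ι} (τ : ι → 𝒵 → EuclideanSpace ℝ (Fin p))
    (hτ : ∀ θ ∈ Θ, Measurable (τ θ)) {M b c : ℝ} (hM : 1 ≤ M)
    (hτi : ∀ θ ∈ Θ, Integrable (fun x => Real.exp (6 * ‖τ θ x‖)) P)
    (hτM : ∀ θ ∈ Θ, ∫ x, Real.exp (6 * ‖τ θ x‖) ∂P ≤ M)
    (N : ℕ → Finset ι) (hN : ∀ k, ↑(N k) ⊆ Θ)
    (hcard : ∀ k : ℕ, Real.log (N k).card ≤ c * (k + 1)) (hb : 0 < b) (hbM : M ≤ b ^ 4)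
    (hnet : ∀ k, ∀ θ ∈ Θ, ∃ θ' ∈ N k, ∫ x, ‖τ θ x - τ θ' x‖ ∂P ≤ (b * (2 ^ (k + 1))⁻¹) ^ 4)
    (hmpos : 0 < m) (K : ℕ) (hK : ∀ k ≤ K, (b * (2 ^ k)⁻¹)⁻¹ ≤ √m) :
    ∃ R : (Fin m → 𝒵) → ℝ≥0∞, Measurable R ∧
      (∀ θ ∈ N K, ∀ z, ENNReal.ofReal √m
        * devNorm P (sliceMeasure p) (sliceDiff (τ θ) fun _ => 0) z ≤ R z) ∧
      ∫⁻ z, R z ∂(Measure.pi fun _ => P) ≤ ENNReal.ofReal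
        (∑ k ∈ Finset.range (K + 1), b * (2 ^ k)⁻¹ * (c * (k + 1) + pairConst M + 1)) := by
  have hM0 : 0 ≤ M := zero_le_one.trans hM
  have hpc := pairConst_nonneg hM0
  have hterm : ∀ k : ℕ, 0 ≤ b * (2 ^ k)⁻¹ * (c * (k + 1) + pairConst M + 1) := by
    intro k
    have h1 : 0 ≤ c * (k + 1) := (Real.log_natCast_nonneg _).trans (hcard k)
    positivity
  have hlink : ∀ k, b * (2 ^ k)⁻¹ * (Real.log (N k).card + pairConst M + 1)
      ≤ b * (2 ^ k)⁻¹ * (c * (k + 1) + pairConst M + 1) := by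
    intro k
    gcongr
    exact hcard k
  induction K with
  | zero =>
    obtain ⟨R, hRm, hR, hRi⟩ := exists_majorant_sliceDiff (P := P) (m := m) (N 0) τ
      (fun _ _ => 0) (fun θ hθ => hτ θ (hN 0 hθ)) (fun _ _ => measurable_const) hmpos hM0
      (β := b * (2 ^ 0)⁻¹) (by positivity) (hK 0 le_rfl) (fun θ hθ => hτi θ (hN 0 hθ))
      (fun _ _ => by simp) (fun θ hθ => hτM θ (hN 0 hθ)) (fun _ _ => by simpa using hM)
      -- The chain starts at the zero map, at distance at most `M ≤ b ^ 4`.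
      (fun θ hθ => by
        have hθ' := hN 0 hθ
        simp only [sub_zero, pow_zero, inv_one, mul_one]
        refine le_trans (integral_mono_of_nonneg
          (Filter.Eventually.of_forall fun _ => norm_nonneg _) (hτi θ hθ')
          (Filter.Eventually.of_forall fun x => ?_)) ((hτM θ hθ').trans hbM)
        have := Real.add_one_le_exp (6 * ‖τ θ x‖)
        simp only
        linarith [norm_nonneg (τ θ x)])
    refine ⟨R, hRm, hR, hRi.trans (ENNReal.ofReal_le_ofReal ?_)⟩
    simpa using hlink 0
  | succ k ih =>
    obtain ⟨R₀, hR₀m, hR₀, hR₀i⟩ := ih fun j hj => hK j (hj.trans k.le_succ)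
    -- `π` sends a point to its neighbour in the coarser net. The net at level `k` is fine enough
    -- for scale `b * 2⁻⁽ᵏ⁺¹⁾`, the scale of the link from level `k + 1` down to `k`.
    choose! π hπN hπ using hnet k
    obtain ⟨R, hRm, hR, hRi⟩ := exists_majorant_sliceDiff (P := P) (m := m) (N (k + 1)) τ
      (fun θ => τ (π θ)) (fun θ hθ => hτ θ (hN _ hθ))
      (fun θ hθ => hτ _ (hN _ (hπN θ (hN _ hθ)))) hmpos hM0
      (β := b * (2 ^ (k + 1))⁻¹) (by positivity) (hK (k + 1) le_rfl)
      (fun θ hθ => hτi θ (hN _ hθ)) (fun θ hθ => hτi _ (hN _ (hπN θ (hN _ hθ))))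
      (fun θ hθ => hτM θ (hN _ hθ)) (fun θ hθ => hτM _ (hN _ (hπN θ (hN _ hθ))))
      (fun θ hθ => hπ θ (hN _ hθ))
    refine ⟨fun z => R₀ z + R z, hR₀m.add hRm, fun θ hθ z => ?_, ?_⟩
    · have hθ' := hN _ hθ
      have h1 := devNorm_sliceDiff_triangle (P := P) (hτ θ hθ') (hτ _ (hN _ (hπN θ hθ')))
        (measurable_const (a := (0 : EuclideanSpace ℝ (Fin p)))) z
      calc _ ≤ ENNReal.ofReal √m * (devNorm P (sliceMeasure p) (sliceDiff (τ θ) (τ (π θ))) z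
            + devNorm P (sliceMeasure p) (sliceDiff (τ (π θ)) fun _ => 0) z) := by gcongr
        _ ≤ R z + R₀ z := by
            rw [mul_add]
            exact add_le_add (hR θ hθ z) (hR₀ _ (hπN θ hθ') z)
        _ = _ := add_comm _ _
    · rw [lintegral_add_left hR₀m, Finset.sum_range_succ,
        ENNReal.ofReal_add (Finset.sum_nonneg fun j _ => hterm j) (hterm _)]
      exact add_le_add hR₀i (hRi.trans (ENNReal.ofReal_le_ofReal (hlink _)))

lemma sum_succ_mul_inv_two_pow (n : ℕ) :
    ∑ k ∈ Finset.range n, ((k : ℝ) + 1) * (2 ^ k)⁻¹ = 4 - (n + 2) * 2 * (2 ^ n)⁻¹ := by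
  induction n with
  | zero => norm_num
  | succ n ih =>
    rw [Finset.sum_range_succ, ih, pow_succ]
    push_cast
    field_simp
    ring

lemma sum_chain_le {b c C : ℝ} (hb : 0 ≤ b) (hc : 0 ≤ c) (hC : 0 ≤ C) (n : ℕ) :
    ∑ k ∈ Finset.range n, b * (2 ^ k)⁻¹ * (c * (k + 1) + C + 1) ≤ 4 * (b * (c + C + 1)) := by
  calc ∑ k ∈ Finset.range n, b * (2 ^ k)⁻¹ * (c * (k + 1) + C + 1)
      ≤ ∑ k ∈ Finset.range n, b * (c + C + 1) * (((k : ℝ) + 1) * (2 ^ k)⁻¹) := by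
        refine Finset.sum_le_sum fun k _ => ?_
        have h1 : c * (k + 1) + C + 1 ≤ (c + C + 1) * ((k : ℝ) + 1) := by
          nlinarith [k.cast_nonneg (α := ℝ), mul_nonneg hC (k.cast_nonneg (α := ℝ))]
        calc b * (2 ^ k)⁻¹ * (c * (k + 1) + C + 1)
            ≤ b * (2 ^ k)⁻¹ * ((c + C + 1) * ((k : ℝ) + 1)) := by gcongr
          _ = _ := by ring
    _ = b * (c + C + 1) * (4 - (n + 2) * 2 * (2 ^ n)⁻¹) := by
        rw [← Finset.mul_sum, sum_succ_mul_inv_two_pow]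
    _ ≤ b * (c + C + 1) * 4 := by
        gcongr
        have : (0 : ℝ) ≤ (n + 2) * 2 * (2 ^ n)⁻¹ := by positivity
        linarith
    _ = _ := by ring

/-- The least `K` with `√m ≤ 16 ^ K`: deep enough for the remainder. By minimality `256 ^ (K - 1) <
m` when `K > 0`, so `2 ^ k ≤ 2 √m` along the chain and the scales stay admissible. -/
lemma exists_chain_depth (hmpos : 0 < m) :
    ∃ K : ℕ, m ≤ 256 ^ K ∧ ∀ k ≤ K, 4 ^ k ≤ 4 * m := by
  have hex : ∃ K : ℕ, m ≤ 256 ^ K := ⟨m, (Nat.lt_pow_self (by norm_num)).le⟩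
  classical
  refine ⟨Nat.find hex, Nat.find_spec hex, fun k hk => ?_⟩
  rcases hK : Nat.find hex with _ | n
  · have : k = 0 := by omega
    subst this
    omega
  · have h1 : 256 ^ n < m := not_le.1 (Nat.find_min hex (by omega))
    calc 4 ^ k ≤ 4 ^ (n + 1) := Nat.pow_le_pow_right (by norm_num) (by omega)
      _ = 4 * 4 ^ n := by ring
      _ ≤ 4 * 256 ^ n := by gcongr; norm_num
      _ ≤ _ := by omega

end Chaining

/-! ### Uniform control over the parameter set. -/

section Uniform

variable {𝒵 : Type*} [MeasurableSpace 𝒵] {P : Measure 𝒵} [IsProbabilityMeasure P] {d p : ℕ}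

/-- The uniform sliced deviation, scaled by `√m`, has a majorant of bounded mean. -/
theorem exists_uniform_majorant {Θ : Set (EuclideanSpace ℝ (Fin d))}
    (hΘ : Bornology.IsBounded Θ)
    (τ : EuclideanSpace ℝ (Fin d) → 𝒵 → EuclideanSpace ℝ (Fin p))
    (hτ : ∀ θ ∈ Θ, Measurable (τ θ)) (L : 𝒵 → ℝ) (hLm : Measurable L) (hL0 : ∀ x, 0 ≤ L x)
    (hL : Integrable L P)
    (hLip : ∀ᵐ x ∂P, ∀ θ₁ ∈ Θ, ∀ θ₂ ∈ Θ, ‖τ θ₁ x - τ θ₂ x‖ ≤ L x * ‖θ₁ - θ₂‖)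
    (K : ℝ≥0) (hsub : ∀ θ ∈ Θ, psi2NormVec (P.map (τ θ)) ≤ K) :
    ∃ B : ℝ, 0 < B ∧ ∀ m : ℕ, 1 ≤ m → ∃ R : (Fin m → 𝒵) → ℝ≥0∞, Measurable R ∧
      (∀ᵐ z ∂(Measure.pi fun _ : Fin m => P), ∀ θ ∈ Θ, ENNReal.ofReal √m
        * slicedW (empirical fun j => τ θ (z j)) (P.map (τ θ)) ≤ R z) ∧
      ∫⁻ z, R z ∂(Measure.pi fun _ => P) ≤ ENNReal.ofReal B := by
  obtain ⟨c, hc, hnet⟩ := exists_net hΘ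
  choose N hNΘ hNcard hN using hnet
  set EL := ∫ x, L x ∂P with hEL
  have hEL0 : 0 ≤ EL := integral_nonneg hL0
  set M := momentConst p K with hMdef
  have hM1 : 1 ≤ M := by
    rw [hMdef, momentConst]
    have : (0 : ℝ) ≤ p * (Real.exp (9 * p ^ 2 * ((K : ℝ) + 1) ^ 2) * 2) := by positivity
    linarith
  -- The summand 2 yields `β⁻¹ ≤ √m` from `2 ^ k ≤ 2 √m`, `M` serves the first link, and `16 * d *
  -- EL` converts the mesh `d * 16⁻ᵏ` into `β ^ 4`.
  set b := 2 + M + 16 * d * EL with hb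
  have hdE : 0 ≤ 16 * d * EL := by positivity
  have hb2 : 2 ≤ b := by linarith
  have hb4 : b ≤ b ^ 4 := le_self_pow₀ (by linarith) (by norm_num)
  have hD : ∀ θ ∈ Θ, ∀ θ' ∈ Θ, ∫ x, ‖τ θ x - τ θ' x‖ ∂P ≤ EL * ‖θ - θ'‖ := by
    intro θ hθ θ' hθ'
    rw [hEL, ← integral_mul_const]
    refine integral_mono_of_nonneg (Filter.Eventually.of_forall fun _ => norm_nonneg _)
      (hL.mul_const _) ?_
    filter_upwards [hLip] with x hx using hx θ hθ θ' hθ'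
  have hDi : ∀ θ ∈ Θ, ∀ θ' ∈ Θ, Integrable (fun x => ‖τ θ x - τ θ' x‖) P := by
    intro θ hθ θ' hθ'
    refine Integrable.mono' (hL.mul_const ‖θ - θ'‖)
      ((hτ θ hθ).sub (hτ θ' hθ')).norm.aestronglyMeasurable ?_
    filter_upwards [hLip] with x hx
    rw [norm_norm]
    exact hx θ hθ θ' hθ'
  have hnet' : ∀ k, ∀ θ ∈ Θ, ∃ θ' ∈ N k,
      ∫ x, ‖τ θ x - τ θ' x‖ ∂P ≤ (b * (2 ^ (k + 1))⁻¹) ^ 4 := by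
    intro k θ hθ
    obtain ⟨θ', hθ', hdist⟩ := hN k θ hθ
    refine ⟨θ', hθ', (hD θ hθ θ' (hNΘ k hθ')).trans ?_⟩
    have h16 : ((2 : ℝ) ^ (k + 1)) ^ 4 = 16 * 16 ^ k := by
      rw [← pow_mul, mul_comm, pow_mul, pow_succ]
      norm_num
      ring
    calc EL * ‖θ - θ'‖ ≤ EL * (d * (16 ^ k)⁻¹) := by gcongr
      _ = 16 * d * EL * (16 * 16 ^ k)⁻¹ := by field_simp
      _ ≤ b ^ 4 * (16 * 16 ^ k)⁻¹ := by gcongr; linarith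
      _ = _ := by rw [mul_pow, inv_pow, h16]
  have hpc := pairConst_nonneg (zero_le_one.trans hM1)
  set B₁ := 4 * (b * (c + pairConst M + 1)) with hB₁
  have hB₁0 : 0 ≤ B₁ := by positivity
  refine ⟨B₁ + 2 * d * EL + 1, by positivity, fun m hm => ?_⟩
  have hmr : (0 : ℝ) < m := by exact_mod_cast hm
  obtain ⟨k₀, hk₀, hk₀'⟩ := exists_chain_depth hm
  have hdepth : ∀ k ≤ k₀, (b * (2 ^ k)⁻¹)⁻¹ ≤ √m := by
    intro k hk
    rw [mul_inv, inv_inv]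
    have h1 : (2 : ℝ) ^ k ≤ 2 * √m := by
      refine le_of_sq_le_sq ?_ (by positivity)
      rw [mul_pow, Real.sq_sqrt hmr.le, ← pow_mul, mul_comm, pow_mul]
      norm_num
      exact_mod_cast hk₀' k hk
    calc b⁻¹ * 2 ^ k ≤ 2⁻¹ * (2 * √m) := by gcongr
      _ = √m := by ring
  obtain ⟨R, hRm, hR, hRi⟩ := exists_majorant_chain (P := P) τ hτ hM1
    (fun θ hθ => integrable_exp_norm_of_psi2NormVec_le (hτ θ hθ) (hsub θ hθ))
    (fun θ hθ => integral_exp_norm_le_of_psi2NormVec_le (hτ θ hθ) (hsub θ hθ))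
    N hNΘ hNcard (by positivity) (by linarith) hnet' hm k₀ hdepth
  have hsqrt : √m * (16 ^ k₀)⁻¹ ≤ 1 := by
    rw [← div_eq_mul_inv, div_le_one (by positivity)]
    refine Real.sqrt_le_iff.2 ⟨by positivity, ?_⟩
    rw [← pow_mul, mul_comm, pow_mul]
    norm_num
    exact_mod_cast hk₀
  set S : (Fin m → 𝒵) → ℝ := fun z => d * ((m : ℝ)⁻¹ * ∑ j, L (z j) + EL) with hS
  have hSm : Measurable S := by fun_prop
  have hS0 : ∀ z, 0 ≤ S z := fun z => by
    have : 0 ≤ ∑ j, L (z j) := Finset.sum_nonneg fun j _ => hL0 _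
    positivity
  have hLj : ∀ j : Fin m, Integrable (fun z : Fin m → 𝒵 => L (z j)) (Measure.pi fun _ => P) :=
    fun j => (measurePreserving_eval (fun _ : Fin m => P) j).integrable_comp_of_integrable hL
  have hSi₁ : Integrable (fun z : Fin m → 𝒵 => (m : ℝ)⁻¹ * ∑ j, L (z j))
      (Measure.pi fun _ => P) := (integrable_finsetSum _ fun j _ => hLj j).const_mul _
  have hSi : Integrable S (Measure.pi fun _ => P) :=
    (hSi₁.add (integrable_const _)).const_mul _
  have hSint : ∫ z, S z ∂(Measure.pi fun _ => P) = 2 * d * EL := by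
    rw [hS, integral_const_mul, integral_add hSi₁ (integrable_const _), integral_const_mul,
      integral_finsetSum _ fun j _ => hLj j]
    have : ∀ j : Fin m, ∫ z : Fin m → 𝒵, L (z j) ∂(Measure.pi fun _ => P) = EL :=
      fun j => integral_comp_eval (μ := fun _ : Fin m => P) hLm.aestronglyMeasurable
    simp only [this, Finset.sum_const, Finset.card_univ, Fintype.card_fin, nsmul_eq_mul,
      integral_const, probReal_univ, one_smul]
    field_simp
    ring
  -- The exceptional set of the Lipschitz bound does not depend on the parameters, so finitely many
  -- null sets suffice although `Θ` may be uncountable.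
  have hae : ∀ᵐ z ∂(Measure.pi fun _ : Fin m => P), ∀ j, ∀ θ₁ ∈ Θ, ∀ θ₂ ∈ Θ,
      ‖τ θ₁ (z j) - τ θ₂ (z j)‖ ≤ L (z j) * ‖θ₁ - θ₂‖ :=
    ae_all_iff.2 fun j =>
      (measurePreserving_eval (fun _ : Fin m => P) j).quasiMeasurePreserving.ae hLip
  refine ⟨fun z => R z + ENNReal.ofReal (S z), hRm.add hSm.ennreal_ofReal, ?_, ?_⟩
  · filter_upwards [hae] with z hz θ hθ
    obtain ⟨θ', hθ', hdist⟩ := hN k₀ θ hθ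
    have hθ'Θ := hNΘ k₀ hθ'
    have h1 := devNorm_le (measurable_sliceDiff (hτ θ hθ) (hτ θ' hθ'Θ))
      (abs_sliceDiff_le_one _ _) (fun _ => norm_nonneg _) (hDi θ hθ θ' hθ'Θ)
      (lintegral_abs_sliceDiff_le (hτ θ hθ) (hτ θ' hθ'Θ)) z
    -- Below the finest mesh the Lipschitz bound gains `16 ^ (-k₀)`, which absorbs the factor `√m`.
    have h2 : √m * ((m : ℝ)⁻¹ * ∑ j, ‖τ θ (z j) - τ θ' (z j)‖
        + ∫ x, ‖τ θ x - τ θ' x‖ ∂P) ≤ S z := by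
      have hA : 0 ≤ (m : ℝ)⁻¹ * ∑ j, L (z j) + EL := by
        have : 0 ≤ ∑ j, L (z j) := Finset.sum_nonneg fun j _ => hL0 _
        positivity
      calc _ ≤ √m * ((m : ℝ)⁻¹ * ∑ j, L (z j) * ‖θ - θ'‖ + EL * ‖θ - θ'‖) := by
            gcongr with j
            · exact hz j θ hθ θ' hθ'Θ
            · exact hD θ hθ θ' hθ'Θ
        _ = √m * (((m : ℝ)⁻¹ * ∑ j, L (z j) + EL) * ‖θ - θ'‖) := by
            rw [← Finset.sum_mul]
            ring
        _ ≤ √m * (((m : ℝ)⁻¹ * ∑ j, L (z j) + EL) * (d * (16 ^ k₀)⁻¹)) := by gcongr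
        _ = √m * (16 ^ k₀)⁻¹ * S z := by simp only [hS]; ring
        _ ≤ 1 * S z := mul_le_mul_of_nonneg_right hsqrt (hS0 z)
        _ = _ := one_mul _
    calc ENNReal.ofReal √m * slicedW (empirical fun j => τ θ (z j)) (P.map (τ θ))
        ≤ ENNReal.ofReal √m * (devNorm P (sliceMeasure p) (sliceDiff (τ θ) (τ θ')) z
          + devNorm P (sliceMeasure p) (sliceDiff (τ θ') fun _ => 0) z) := by
          refine mul_le_mul' le_rfl ((slicedW_le_devNorm hm (hτ θ hθ) z).trans ?_)
          exact devNorm_sliceDiff_triangle (hτ θ hθ) (hτ θ' hθ'Θ) measurable_const z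
      _ ≤ ENNReal.ofReal (S z) + R z := by
          rw [mul_add]
          refine add_le_add ?_ (hR θ' hθ' z)
          refine (mul_le_mul' le_rfl h1).trans ?_
          rw [← ENNReal.ofReal_mul (Real.sqrt_nonneg _)]
          exact ENNReal.ofReal_le_ofReal h2
      _ = _ := add_comm _ _
  · rw [lintegral_add_left hRm, ← ofReal_integral_eq_lintegral_ofReal hSi
      (Filter.Eventually.of_forall hS0), hSint]
    have h3 := hRi.trans (ENNReal.ofReal_le_ofReal
      (sum_chain_le (by positivity) hc hpc (k₀ + 1)))
    refine (add_le_add h3 le_rfl).trans ?_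
    rw [← ENNReal.ofReal_add hB₁0 (by positivity)]
    exact ENNReal.ofReal_le_ofReal (by linarith)

end Uniform

end SlicedW

end

/-! ### The stochastic bound. -/

theorem mainTheorem6 {d p : ℕ} {𝒵 : Type*} [MeasurableSpace 𝒵]
    (PZ : Measure 𝒵) [IsProbabilityMeasure PZ]
    (Θ : Set (EuclideanSpace ℝ (Fin d))) (hΘ : IsCompact Θ)
    (τ : EuclideanSpace ℝ (Fin d) → 𝒵 → EuclideanSpace ℝ (Fin p))
    (hτ : ∀ θ ∈ Θ, Measurable (τ θ))
    (L : 𝒵 → ℝ) (hL : Integrable L PZ)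
    (hLip : ∀ᵐ z ∂PZ, ∀ θ₁ ∈ Θ, ∀ θ₂ ∈ Θ, ‖τ θ₁ z - τ θ₂ z‖ ≤ L z * ‖θ₁ - θ₂‖)
    (K : ℝ≥0) (hsub : ∀ θ ∈ Θ, SlicedW.psi2NormVec (PZ.map (τ θ)) ≤ K) :
    SlicedW.IsBigOp (fun m => Measure.pi (fun _ : Fin m => PZ))
      (fun m z => ⨆ θ ∈ Θ,
        SlicedW.slicedW (SlicedW.empirical (fun j : Fin m => τ θ (z j))) (PZ.map (τ θ)))
      (fun m => (m : ℝ) ^ (-(1 / 2) : ℝ)) := by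
  -- `L` is only almost everywhere measurable and may be negative; the absolute value of a
  -- measurable version remains a Lipschitz constant.
  have hmk := hL.1.ae_eq_mk
  have hLip' : ∀ᵐ z ∂PZ, ∀ θ₁ ∈ Θ, ∀ θ₂ ∈ Θ,
      ‖τ θ₁ z - τ θ₂ z‖ ≤ |hL.1.mk L z| * ‖θ₁ - θ₂‖ := by
    filter_upwards [hLip, hmk] with z hz hz' θ₁ h₁ θ₂ h₂
    refine (hz θ₁ h₁ θ₂ h₂).trans ?_
    rw [hz']
    gcongr
    exact le_abs_self _
  obtain ⟨B, hB, hmaj⟩ := SlicedW.exists_uniform_majorant hΘ.isBounded τ hτ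
    (fun z => |hL.1.mk L z|) hL.1.stronglyMeasurable_mk.measurable.abs (fun _ => abs_nonneg _)
    (hL.congr hmk).abs hLip' K hsub
  intro ε hε
  refine ⟨B / ε, by positivity, fun m hm => ?_⟩
  obtain ⟨R, hRm, hR, hRi⟩ := hmaj m hm
  have hmr : (0 : ℝ) < m := by exact_mod_cast hm
  have hsq : 0 < √(m : ℝ) := Real.sqrt_pos.2 hmr
  have hpow : √(m : ℝ) * (B / ε * (m : ℝ) ^ (-(1 / 2) : ℝ)) = B / ε := by
    rw [Real.rpow_neg hmr.le, ← Real.sqrt_eq_rpow]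
    field_simp
  -- Markov's inequality is applied to the measurable `R`; the supremum enters only through
  -- monotonicity of outer measure, so its measurability is not needed.
  calc _ ≤ (Measure.pi fun _ : Fin m => PZ) {z | ENNReal.ofReal (B / ε) ≤ R z} := by
        refine measure_mono_ae ?_
        filter_upwards [hR] with z hz hlt
        have hsup : (⨆ θ ∈ Θ, SlicedW.slicedW (SlicedW.empirical (fun j : Fin m => τ θ (z j)))
            (PZ.map (τ θ))) ≤ R z / ENNReal.ofReal √m := by
          refine iSup₂_le fun θ hθ => ?_
          rw [ENNReal.le_div_iff_mul_le (Or.inl (ENNReal.ofReal_pos.2 hsq).ne')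
            (Or.inl ENNReal.ofReal_ne_top), mul_comm]
          exact hz θ hθ
        have h1 := (le_of_lt hlt).trans hsup
        rw [ENNReal.le_div_iff_mul_le (Or.inl (ENNReal.ofReal_pos.2 hsq).ne')
            (Or.inl ENNReal.ofReal_ne_top), mul_comm, ← ENNReal.ofReal_mul hsq.le, hpow] at h1
        exact h1
    _ ≤ (∫⁻ z, R z ∂(Measure.pi fun _ => PZ)) / ENNReal.ofReal (B / ε) :=
        meas_ge_le_lintegral_div hRm.aemeasurable (ENNReal.ofReal_pos.2 (by positivity)).ne'
          ENNReal.ofReal_ne_top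
    _ ≤ ENNReal.ofReal B / ENNReal.ofReal (B / ε) := by gcongr
    _ = ENNReal.ofReal ε := by
        rw [← ENNReal.ofReal_div_of_pos (by positivity)]
        congr 1
        field_simp
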